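/- **Setup.** A *chain of $g$ loops* $\Gamma$ is the metric graph with vertices $w_0,\dots,w_g$ and $v_1,\dots,v_{g+1}$, with a bridge of length $n_k$ joining $w_k$ to $v_{k+1}$ for $0\le k\le g$, and with two edges, of lengths $\ell_k$ (top) and $m_k$ (bottom), joining $v_k$ to $w_k$ for $1\le k\le g$. For a continuous piecewise linear function $\psi$ with integral slopes, $\operatorname{div}\psi$ is the divisor whose coefficient at a point is the sum of the incoming slopes of $\psi$ there; divisors $D,D'$ are equivalent, $D\sim D'$, if $D'=D+\operatorname{div}\psi$ for some such $\psi$, and rank means Baker–Norine rank. Let $D$ be a divisor of rank $r$ on $\Gamma$. Its class is *vertex avoiding* if for every $0\le i\le r$ there is exactly one effective divisor $D_i\sim D$ with $D_i\ge i\,w_0+(r-i)\,v_{g+1}$, and $D_i-i\,w_0-(r-i)\,v_{g+1}$ has no vertex in its support. For a multiset $I\subset\{0,\dots,r\}$ of size $m$ let $\psi_I$ be a piecewise linear function with $mD+\operatorname{div}\psi_I=\sum_{i\in I}D_i$; it is unique up to an additive constant. A finite family $(f_i)_{i\in A}$ of functions on $\Gamma$ is *tropically dependent* if there are real constants $c_i$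 such that at every point of $\Gamma$ the minimum $\min_{i\in A}(f_i+c_i)$ is attained for at least two indices $i$, and *tropically independent* otherwise. Let $r\ge 3$, $s\ge 1$, $\rho\ge 0$, $m\ge 1$ be integers and put $g=(r+1)s+\rho$ and $d=g+r-s$. Fix an integer $b\ge 1$ (a block length; for $b=1$ condition (iv) below repeats (ii) and may be dropped). For a real number $C>0$, the edge lengths of a chain of $g$ loops are *$C$-admissible* (with respect to $r$ and $b$) if - (i) $4g\,m_k<\ell_k$ for $1\le k\le g$; - (ii) $C\,\ell_k\le\min\{n_{k-1},n_k\}$ for $1\le k\le g$; - (iii) there is no nontrivial relation $c_1m_1+\dots+c_gm_g=0$ with integers $|c_k|\le g+1$; - (iv) for every integer $0\le\alpha\le r$ with $(\alpha+1)b\le g$, $$C\Bigl(\sum_{i=\alpha b+1}^{(\alpha+1)b}\ell_i+\sum_{i=\alpha b+1}^{(\alpha+1)b-1}n_i\Bigr)\le\min\{n_{\alpha b},\,n_{(\alpha+1)b}\}.$$ The *tropical maximal rank conjecture for $(r,s,\rho,m)$* (with block length $b$) is the following assertion: there is a constant $C>0$, depending only on $b,r,s,\rho,m$, such that every chain of $g$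 loops with $C$-admissible edge lengths carries a divisor $D$ of rank $r$ and degree $d$ whose class is vertex avoiding, together with a set $\mathcal A$ of multisets of size $m$ in $\{0,\dots,r\}$ such that $$|\mathcal A|=\min\Bigl\{\tbinom{r+m}{m},\,md-g+1\Bigr\}$$ and the family $(\psi_I)_{I\in\mathcal A}$ is tropically independent. **Theorem 1.1.** Let $r\ge3$, $s\ge1$, $\rho\ge0$, $m\ge1$, $b\ge1$ be integers, and suppose that $(r,s,\rho,m)$ is in the *injective range*, i.e. $\binom{r+m}{m}\le md-g+1$. If the tropical maximal rank conjecture (with block length $b$) holds for $(r,s,\rho,m)$, then it holds (with the same block length $b$) for $(r,s,\rho+1,m)$ and for $(r,s+1,\rho,m)$. -/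

import Mathlib

open Filter Topology

/-! ### Metric graphs, piecewise linear functions, divisors -/

/-- A metric graph presented by a multigraph: every edge `e` is a closed interval of
length `len e > 0` glued at its two ends to the vertices `src e` and `tgt e`. -/
structure MetricGraph (V E : Type) where
  src : E → V
  tgt : E → V
  len : E → ℝ
  len_pos : ∀ e, 0 < len e

/-- Immediately to the right of `t`, the function `φ` is affine, and its slope when moving away
from `t` is the integer `k`. -/
def HasRightSlope (φ : ℝ → ℝ) (t : ℝ) (k : ℤ) : Prop :=
  ∀ᶠ u in 𝓝[>] t, φ u = φ t + k * (u - t)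

/-- Immediately to the left of `t`, the function `φ` is affine, and its slope when moving away
from `t` (that is, to the left) is the integer `k`. -/
def HasLeftSlope (φ : ℝ → ℝ) (t : ℝ) (k : ℤ) : Prop :=
  ∀ᶠ u in 𝓝[<] t, φ u = φ t + k * (t - u)

theorem HasRightSlope.unique {φ : ℝ → ℝ} {t : ℝ} {k l : ℤ}
    (hk : HasRightSlope φ t k) (hl : HasRightSlope φ t l) : k = l := by
  obtain ⟨u, ⟨h1, h2⟩, h3⟩ := ((hk.and hl).and self_mem_nhdsWithin).exists
  have h3 : t < u := h3
  have h4 : (k : ℝ) * (u - t) = l * (u - t) := by linarith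
  exact_mod_cast mul_right_cancel₀ (sub_ne_zero.2 h3.ne') h4

theorem HasLeftSlope.unique {φ : ℝ → ℝ} {t : ℝ} {k l : ℤ}
    (hk : HasLeftSlope φ t k) (hl : HasLeftSlope φ t l) : k = l := by
  obtain ⟨u, ⟨h1, h2⟩, h3⟩ := ((hk.and hl).and self_mem_nhdsWithin).exists
  have h3 : u < t := h3
  have h4 : (k : ℝ) * (t - u) = l * (t - u) := by linarith
  exact_mod_cast mul_right_cancel₀ (sub_ne_zero.2 h3.ne') h4

/-- The outgoing slope of `φ` at `t` to the right (used only where it exists). -/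
noncomputable def rightSlope (φ : ℝ → ℝ) (t : ℝ) : ℤ :=
  Classical.epsilon fun k => HasRightSlope φ t k

/-- The outgoing slope of `φ` at `t` to the left (used only where it exists). -/
noncomputable def leftSlope (φ : ℝ → ℝ) (t : ℝ) : ℤ :=
  Classical.epsilon fun k => HasLeftSlope φ t k

theorem HasRightSlope.rightSlope_eq {φ : ℝ → ℝ} {t : ℝ} {k : ℤ}
    (hk : HasRightSlope φ t k) : rightSlope φ t = k :=
  (Classical.epsilon_spec (p := fun k => HasRightSlope φ t k) ⟨k, hk⟩).unique hk

theorem HasLeftSlope.leftSlope_eq {φ : ℝ → ℝ} {t : ℝ} {k : ℤ}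
    (hk : HasLeftSlope φ t k) : leftSlope φ t = k :=
  (Classical.epsilon_spec (p := fun k => HasLeftSlope φ t k) ⟨k, hk⟩).unique hk

namespace MetricGraph

/-- The points of the metric graph: the vertices and the interior points of the edges. -/
abbrev Point {V E : Type} (G : MetricGraph V E) : Type :=
  V ⊕ (Σ e : E, Set.Ioo (0 : ℝ) (G.len e))

/-- A vertex as a point. -/
abbrev vert {V E : Type} (G : MetricGraph V E) (x : V) : G.Point := Sum.inl x

open Classical in
/-- The point of the edge `e` at distance `t ∈ [0, len e]` from `src e`
(for `t` outside of this interval, the nearer end of the edge). -/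
noncomputable def pt {V E : Type} (G : MetricGraph V E) (e : E) (t : ℝ) : G.Point :=
  if h : t ∈ Set.Ioo (0 : ℝ) (G.len e) then Sum.inr ⟨e, ⟨t, h⟩⟩
  else if t ≤ 0 then G.vert (G.src e) else G.vert (G.tgt e)

/-- Continuous piecewise linear functions with integral slopes: near every point, in every
direction, the function is affine with integral slope. Since the graph is compact, finitely many
linear pieces suffice. -/
def IsPL {V E : Type} (G : MetricGraph V E) (f : G.Point → ℝ) : Prop :=
  ∀ (e : E) (t : ℝ),
    (0 ≤ t → t < G.len e → ∃ k : ℤ, HasRightSlope (fun u => f (G.pt e u)) t k) ∧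
    (0 < t → t ≤ G.len e → ∃ k : ℤ, HasLeftSlope (fun u => f (G.pt e u)) t k)

open Classical in
/-- The coefficient of `div f` at a point: the sum of the incoming slopes of `f`, that is, minus
the sum of the outgoing slopes over all directions at this point. -/
noncomputable def ord {V E : Type} [Fintype E] (G : MetricGraph V E) (f : G.Point → ℝ) :
    G.Point → ℤ
  | Sum.inl x =>
      - ((∑ e, if G.src e = x then rightSlope (fun u => f (G.pt e u)) 0 else 0) +
         (∑ e, if G.tgt e = x then leftSlope (fun u => f (G.pt e u)) (G.len e) else 0))
  | Sum.inr ⟨e, t⟩ =>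
      - (rightSlope (fun u => f (G.pt e u)) t + leftSlope (fun u => f (G.pt e u)) t)

/-- Divisors: finite formal integral combinations of points. -/
abbrev Divisor {V E : Type} (G : MetricGraph V E) : Type := G.Point →₀ ℤ

/-- The degree of a divisor. -/
noncomputable def degree {V E : Type} {G : MetricGraph V E} (D : G.Divisor) : ℤ :=
  D.sum fun _ a => a

/-- The piecewise linear function `f` satisfies `D + div f = D'`. -/
def Moves {V E : Type} [Fintype E] (G : MetricGraph V E) (f : G.Point → ℝ)
    (D D' : G.Divisor) : Prop :=
  G.IsPL f ∧ ∀ x, D' x = D x + G.ord f x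

/-- Linear equivalence of divisors. -/
def LinEquiv {V E : Type} [Fintype E] (G : MetricGraph V E) (D D' : G.Divisor) : Prop :=
  ∃ f : G.Point → ℝ, G.Moves f D D'

/-- The (Baker–Norine) rank of `D` is at least `k`: for every effective divisor `F` of degree `k`,
the divisor `D - F` is equivalent to an effective divisor. -/
def RankGE {V E : Type} [Fintype E] (G : MetricGraph V E) (D : G.Divisor) (k : ℕ) : Prop :=
  ∀ F : G.Divisor, 0 ≤ F → degree F = k → ∃ D' : G.Divisor, 0 ≤ D' ∧ G.LinEquiv (D - F) D'

/-- The rank of `D` is equal to `r`. -/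
def HasRank {V E : Type} [Fintype E] (G : MetricGraph V E) (D : G.Divisor) (r : ℕ) : Prop :=
  G.RankGE D r ∧ ¬ G.RankGE D (r + 1)

end MetricGraph

/-- The family of functions `(f i)` for `i ∈ A` is tropically dependent: for suitable real
constants `c i`, the minimum of the `f i + c i` is attained at least twice at every point. -/
def TropicallyDependent {X ι : Type} (f : ι → X → ℝ) (A : Finset ι) : Prop :=
  ∃ c : ι → ℝ, ∀ x : X, ∃ i ∈ A, ∃ j ∈ A, i ≠ j ∧
    f i x + c i = f j x + c j ∧ ∀ k ∈ A, f i x + c i ≤ f k x + c k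

/-- Tropical independence. -/
def TropicallyIndependent {X ι : Type} (f : ι → X → ℝ) (A : Finset ι) : Prop :=
  ¬ TropicallyDependent f A

/-! ### The chain of loops -/

/-- Edge lengths of chains of loops, indexed as is customary: the `k`-th bridge joins `w_k` to
`v_{k+1}` for `0 ≤ k ≤ g`, and the top and bottom edges of the `k`-th loop join `v_k` to `w_k` for
`1 ≤ k ≤ g`. The values at other indices play no role for the chain of `g` loops. -/
structure ChainLengths where
  bridge : ℕ → ℝ
  top : ℕ → ℝ
  bottom : ℕ → ℝ
  bridge_pos : ∀ k, 0 < bridge k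
  top_pos : ∀ k, 0 < top k
  bottom_pos : ∀ k, 0 < bottom k

namespace ChainLengths

/-- The vertices of the chain of `g` loops: `Sum.inl k` is `w_k` and `Sum.inr k` is `v_{k+1}`,
for `0 ≤ k ≤ g`. -/
abbrev Vertex (g : ℕ) : Type := Fin (g + 1) ⊕ Fin (g + 1)

/-- The edges of the chain of `g` loops: `Sum.inl k` is the `k`-th bridge for `0 ≤ k ≤ g`, and
`Sum.inr (Sum.inl k)`, `Sum.inr (Sum.inr k)` are the top and the bottom edge of the loop number
`k + 1`, for `0 ≤ k < g`. -/
abbrev Edge (g : ℕ) : Type := Fin (g + 1) ⊕ (Fin g ⊕ Fin g)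

/-- The chain of `g` loops with bridges. -/
def chain (L : ChainLengths) (g : ℕ) : MetricGraph (Vertex g) (Edge g) where
  src
    | Sum.inl k => Sum.inl k
    | Sum.inr (Sum.inl k) => Sum.inr k.castSucc
    | Sum.inr (Sum.inr k) => Sum.inr k.castSucc
  tgt
    | Sum.inl k => Sum.inr k
    | Sum.inr (Sum.inl k) => Sum.inl k.succ
    | Sum.inr (Sum.inr k) => Sum.inl k.succ
  len
    | Sum.inl k => L.bridge k
    | Sum.inr (Sum.inl k) => L.top (k + 1)
    | Sum.inr (Sum.inr k) => L.bottom (k + 1)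
  len_pos
    | Sum.inl k => L.bridge_pos k
    | Sum.inr (Sum.inl k) => L.top_pos (k + 1)
    | Sum.inr (Sum.inr k) => L.bottom_pos (k + 1)

/-- The left end `w_0` of the chain. -/
def leftEnd (L : ChainLengths) (g : ℕ) : (L.chain g).Point := (L.chain g).vert (Sum.inl 0)

/-- The right end `v_{g+1}` of the chain. -/
def rightEnd (L : ChainLengths) (g : ℕ) : (L.chain g).Point :=
  (L.chain g).vert (Sum.inr (Fin.last g))

/-- Admissible edge lengths for the chain of `g` loops, where `x ≪ y` is read as `C * x ≤ y`.
The last clause says that the blocks numbered `α = 0, …, r`, each consisting of `b` consecutive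
loops, are much shorter than the bridges separating them; for `b = 1` it repeats the second
clause. -/
def Admissible (L : ChainLengths) (g r b : ℕ) (C : ℝ) : Prop :=
  (∀ k ∈ Finset.Icc 1 g, 4 * g * L.bottom k < L.top k) ∧
  (∀ k ∈ Finset.Icc 1 g, C * L.top k ≤ min (L.bridge (k - 1)) (L.bridge k)) ∧
  (∀ c : ℕ → ℤ, (∀ k ∈ Finset.Icc 1 g, |c k| ≤ g + 1) →
    ∑ k ∈ Finset.Icc 1 g, (c k : ℝ) * L.bottom k = 0 → ∀ k ∈ Finset.Icc 1 g, c k = 0) ∧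
  (∀ α : ℕ, α ≤ r → (α + 1) * b ≤ g →
    C * (∑ i ∈ Finset.Icc (α * b + 1) ((α + 1) * b), L.top i +
         ∑ i ∈ Finset.Icc (α * b + 1) ((α + 1) * b - 1), L.bridge i) ≤
      min (L.bridge (α * b)) (L.bridge ((α + 1) * b)))

/-- `D'` is an effective divisor equivalent to `D` with at least `i` chips at `w_0` and at least
`r - i` chips at `v_{g+1}`. -/
def IsSection (L : ChainLengths) (g r : ℕ) (D : (L.chain g).Divisor) (i : Fin (r + 1))
    (D' : (L.chain g).Divisor) : Prop :=
  (L.chain g).LinEquiv D D' ∧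
    Finsupp.single (L.leftEnd g) (i : ℤ) + Finsupp.single (L.rightEnd g) ((r : ℤ) - i) ≤ D' ∧
    0 ≤ D'

/-- The class of `D` (a divisor of rank `r`) is vertex avoiding: for `0 ≤ i ≤ r` there is
exactly one effective divisor `D_i` equivalent to `D` that contains
`i w_0 + (r - i) v_{g+1}`, and the difference is supported away from all vertices. In particular
`D_i` has degree exactly `i` at `w_0` and `r - i` at `v_{g+1}`. -/
def VertexAvoiding (L : ChainLengths) (g r : ℕ) (D : (L.chain g).Divisor) : Prop :=
  ∀ i : Fin (r + 1), ∃ D' : (L.chain g).Divisor, L.IsSection g r D i D' ∧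
    (∀ D'', L.IsSection g r D i D'' → D'' = D') ∧
    ∀ x : Vertex g, D' ((L.chain g).vert x) =
      (Finsupp.single (L.leftEnd g) (i : ℤ) + Finsupp.single (L.rightEnd g) ((r : ℤ) - i) :
        (L.chain g).Divisor) ((L.chain g).vert x)

end ChainLengths

/-! ### The tropical maximal rank conjecture -/

/-- The genus `g = (r + 1) s + ρ`. -/
def genus (r s ρ : ℕ) : ℕ := (r + 1) * s + ρ

/-- The degree `d = g + r - s`. -/
def curveDegree (r s ρ : ℕ) : ℤ := (genus r s ρ : ℤ) + r - s

/-- The expected dimension `m d - g + 1`. -/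
def expectedDim (r s ρ m : ℕ) : ℤ := m * curveDegree r s ρ - genus r s ρ + 1

/-- The injective range. -/
def InjectiveRange (r s ρ m : ℕ) : Prop :=
  ((r + m).choose m : ℤ) ≤ expectedDim r s ρ m

/-- The assertion of the tropical maximal rank conjecture, with parameters `r, s, ρ, m`, for one
chain of `g = (r + 1) s + ρ` loops. The multisets `I` of size `m` in `{0, …, r}` are the elements
of `Sym (Fin (r + 1)) m`. -/
def MaximalRankOn (L : ChainLengths) (r s ρ m : ℕ) : Prop :=
  ∃ D : (L.chain (genus r s ρ)).Divisor,
    (L.chain (genus r s ρ)).HasRank D r ∧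
    MetricGraph.degree D = curveDegree r s ρ ∧
    L.VertexAvoiding (genus r s ρ) r D ∧
    ∃ Di : Fin (r + 1) → (L.chain (genus r s ρ)).Divisor,
      (∀ i, L.IsSection (genus r s ρ) r D i (Di i)) ∧
    ∃ ψ : Sym (Fin (r + 1)) m → (L.chain (genus r s ρ)).Point → ℝ,
      (∀ I, (L.chain (genus r s ρ)).Moves (ψ I) (m • D) ((I : Multiset (Fin (r + 1))).map Di).sum) ∧
    ∃ A : Finset (Sym (Fin (r + 1)) m),
      (A.card : ℤ) = min ((r + m).choose m : ℤ) (expectedDim r s ρ m) ∧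
      TropicallyIndependent ψ A

/-- The tropical maximal rank conjecture for `(r, s, ρ, m)`: it holds on every chain of loops with
generic edge lengths, that is, whenever the edge lengths are admissible, with respect to blocks
of `b` loops and with sufficiently large ratios. -/
def TropicalMaximalRank (b r s ρ m : ℕ) : Prop :=
  ∃ C : ℝ, 0 < C ∧ ∀ L : ChainLengths, L.Admissible (genus r s ρ) r b C → MaximalRankOn L r s ρ m

/-! ### Slopes of functions of a real variable -/

/-! In the injective range the family must consist of all multisets, so the hypothesis says that all
the `ψ_I` on the chain of g loops are independent. Regard this chain as the left part of a longer
one. Extend `D` by one chip on each new loop so that the functions `φ_i` with `D + div φ_i = D_i`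
extend as well. A tropical dependence of the extended sums restricts, with the same constants, to
the first g loops; so independence is inherited, and only rank, degree and vertex avoidance need
care.

On a loop, let ⟨N⟩ be the point equivalent to `N w - (N - 1) v`; thus ⟨0⟩ = v and ⟨1⟩ = w. By Abel's
theorem, c chips at v plus ⟨N⟩ are equivalent to c chips at w plus ⟨N - c⟩. So a multiplicity c
crosses the loop unchanged, leaving a chip behind, unless N - c = 1, when that chip joins the others
and c becomes c + 1. The value N = c is forbidden, as it leaves a chip on v. Condition (i) puts the
other ⟨N - c⟩ in the interior of the top edge.

To raise ρ by one, take N = -1: every multiplicity r - i survives. To raise s by one, remove a chip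
at the right end, so that the multiplicities become r - 1 - i, and attach r + 1 loops with N = r, r
- 1, ..., 0, which restore them one at a time. The last multiplicity is -1 for a while. This is why
`Series` allows arbitrary multiplicities at the right end and demands no effectivity there.

`Wedge.exists_series` carries a series over an attached graph. Uniqueness rests on the rigidity of a
single chip inside a loop, `ord_eq_zero_of_single_pole`; the rank condition rests on Riemann–Roch in
genus one, `exists_effective`, and on the decrease of the multiplicities.
`HasIndependentSeries.succ` is the resulting induction step. Finally, the injective range forces m ≥
2 and persists, since the expected dimension grows by m - 1 and by mr - (r + 1) respectively. -/

theorem HasRightSlope.add {φ χ : ℝ → ℝ} {t : ℝ} {k l : ℤ} (hk : HasRightSlope φ t k)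
    (hl : HasRightSlope χ t l) : HasRightSlope (fun u => φ u + χ u) t (k + l) := by
  filter_upwards [hk, hl] with u h1 h2
  rw [h1, h2]; push_cast; ring

theorem HasLeftSlope.add {φ χ : ℝ → ℝ} {t : ℝ} {k l : ℤ} (hk : HasLeftSlope φ t k)
    (hl : HasLeftSlope χ t l) : HasLeftSlope (fun u => φ u + χ u) t (k + l) := by
  filter_upwards [hk, hl] with u h1 h2
  rw [h1, h2]; push_cast; ring

theorem HasRightSlope.int_mul {φ : ℝ → ℝ} {t : ℝ} {k : ℤ} (hk : HasRightSlope φ t k) (a : ℤ) :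
    HasRightSlope (fun u => a * φ u) t (a * k) := by
  filter_upwards [hk] with u h1
  rw [h1]; push_cast; ring

theorem HasLeftSlope.int_mul {φ : ℝ → ℝ} {t : ℝ} {k : ℤ} (hk : HasLeftSlope φ t k) (a : ℤ) :
    HasLeftSlope (fun u => a * φ u) t (a * k) := by
  filter_upwards [hk] with u h1
  rw [h1]; push_cast; ring

theorem hasRightSlope_const (a t : ℝ) : HasRightSlope (fun _ => a) t 0 := by
  simp [HasRightSlope]

theorem hasLeftSlope_const (a t : ℝ) : HasLeftSlope (fun _ => a) t 0 := by
  simp [HasLeftSlope]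

theorem HasRightSlope.congr {φ χ : ℝ → ℝ} {t b : ℝ} {k : ℤ} (hk : HasRightSlope φ t k)
    (hb : t < b) (h : ∀ u, t ≤ u → u < b → χ u = φ u) : HasRightSlope χ t k := by
  filter_upwards [hk, Ioo_mem_nhdsGT hb] with u h1 h2
  rw [h u h2.1.le h2.2, h t le_rfl hb, h1]

theorem HasLeftSlope.congr {φ χ : ℝ → ℝ} {t a : ℝ} {k : ℤ} (hk : HasLeftSlope φ t k)
    (ha : a < t) (h : ∀ u, a < u → u ≤ t → χ u = φ u) : HasLeftSlope χ t k := by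
  filter_upwards [hk, Ioo_mem_nhdsLT ha] with u h1 h2
  rw [h u h2.1 h2.2.le, h t ha le_rfl, h1]

theorem HasRightSlope.comp_const_sub {φ : ℝ → ℝ} {a t : ℝ} {k : ℤ}
    (hk : HasRightSlope φ (a - t) k) : HasLeftSlope (fun u => φ (a - u)) t k := by
  have h : Tendsto (fun u => a - u) (𝓝[<] t) (𝓝[>] (a - t)) := by
    refine tendsto_nhdsWithin_iff.2 ⟨?_, ?_⟩
    · exact ((continuous_const.sub continuous_id).tendsto t).mono_left nhdsWithin_le_nhds
    · filter_upwards [self_mem_nhdsWithin] with u hu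
      have : u < t := hu
      exact sub_lt_sub_left this a
  filter_upwards [h.eventually hk] with u hu
  rw [hu]; ring

theorem HasLeftSlope.comp_const_sub {φ : ℝ → ℝ} {a t : ℝ} {k : ℤ}
    (hk : HasLeftSlope φ (a - t) k) : HasRightSlope (fun u => φ (a - u)) t k := by
  have h : Tendsto (fun u => a - u) (𝓝[>] t) (𝓝[<] (a - t)) := by
    refine tendsto_nhdsWithin_iff.2 ⟨?_, ?_⟩
    · exact ((continuous_const.sub continuous_id).tendsto t).mono_left nhdsWithin_le_nhds
    · filter_upwards [self_mem_nhdsWithin] with u hu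
      have : t < u := hu
      exact sub_lt_sub_left this a
  filter_upwards [h.eventually hk] with u hu
  rw [hu]; ring

theorem HasRightSlope.continuousWithinAt {φ : ℝ → ℝ} {t : ℝ} {k : ℤ} (hk : HasRightSlope φ t k) :
    ContinuousWithinAt φ (Set.Ioi t) t := by
  have h : Tendsto (fun u => φ t + k * (u - t)) (𝓝[>] t) (𝓝 (φ t)) := by
    have : Continuous fun u : ℝ => φ t + k * (u - t) := by fun_prop
    simpa using (this.tendsto t).mono_left nhdsWithin_le_nhds
  exact h.congr' (hk.mono fun _ hu => hu.symm)

theorem HasLeftSlope.continuousWithinAt {φ : ℝ → ℝ} {t : ℝ} {k : ℤ} (hk : HasLeftSlope φ t k) :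
    ContinuousWithinAt φ (Set.Iio t) t := by
  have h : Tendsto (fun u => φ t + k * (t - u)) (𝓝[<] t) (𝓝 (φ t)) := by
    have : Continuous fun u : ℝ => φ t + k * (t - u) := by fun_prop
    simpa using (this.tendsto t).mono_left nhdsWithin_le_nhds
  exact h.congr' (hk.mono fun _ hu => hu.symm)

/-- Piecewise linear functions with integral slopes on the interval `[a, b]`. -/
def PLOn (φ : ℝ → ℝ) (a b : ℝ) : Prop :=
  ∀ t, (a ≤ t → t < b → ∃ k : ℤ, HasRightSlope φ t k) ∧
    (a < t → t ≤ b → ∃ k : ℤ, HasLeftSlope φ t k)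

/-! ### Concave piecewise linear functions on an interval -/

namespace PLOn

variable {φ : ℝ → ℝ} {a b : ℝ}

theorem right (h : PLOn φ a b) {t : ℝ} (h1 : a ≤ t) (h2 : t < b) :
    HasRightSlope φ t (rightSlope φ t) := by
  obtain ⟨k, hk⟩ := (h t).1 h1 h2
  rwa [hk.rightSlope_eq]

theorem left (h : PLOn φ a b) {t : ℝ} (h1 : a < t) (h2 : t ≤ b) :
    HasLeftSlope φ t (leftSlope φ t) := by
  obtain ⟨k, hk⟩ := (h t).2 h1 h2
  rwa [hk.leftSlope_eq]

theorem mono (h : PLOn φ a b) {a' b' : ℝ} (ha : a ≤ a') (hb : b' ≤ b) : PLOn φ a' b' :=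
  fun t => ⟨fun h1 h2 => (h t).1 (ha.trans h1) (h2.trans_le hb),
    fun h1 h2 => (h t).2 (ha.trans_lt h1) (h2.trans hb)⟩

theorem neg (h : PLOn φ a b) : PLOn (fun u => -φ u) a b := by
  exact fun t => ⟨fun h1 h2 => ⟨_, by simpa using (h.right h1 h2).int_mul (-1)⟩,
    fun h1 h2 => ⟨_, by simpa using (h.left h1 h2).int_mul (-1)⟩⟩

theorem comp_const_sub (h : PLOn φ a b) : PLOn (fun u => φ (a + b - u)) a b := by
  exact fun t => ⟨fun h1 h2 =>
      ⟨_, (h.left (t := a + b - t) (by linarith) (by linarith)).comp_const_sub⟩,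
    fun h1 h2 => ⟨_, (h.right (t := a + b - t) (by linarith) (by linarith)).comp_const_sub⟩⟩

theorem continuousOn (h : PLOn φ a b) : ContinuousOn φ (Set.Icc a b) := by
  intro t ht
  have h1 : ContinuousWithinAt φ (Set.Icc a b ∩ Set.Ioi t) t := by
    rcases ht.2.eq_or_lt with rfl | h2
    · have : Set.Icc a t ∩ Set.Ioi t = ∅ := by
        ext x; simp +contextual
      rw [this]; simp [ContinuousWithinAt]
    · exact (h.right ht.1 h2).continuousWithinAt.mono Set.inter_subset_right
  have h2 : ContinuousWithinAt φ (Set.Icc a b ∩ Set.Iio t) t := by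
    rcases ht.1.eq_or_lt with rfl | h2
    · have : Set.Icc a b ∩ Set.Iio a = ∅ := by
        ext x; simp +contextual
      rw [this]; simp [ContinuousWithinAt]
    · exact (h.left h2 ht.2).continuousWithinAt.mono Set.inter_subset_right
  have h3 := (h1.union h2).union (continuousWithinAt_singleton (f := φ) (x := t))
  refine h3.mono fun x hx => ?_
  rcases lt_trichotomy x t with h | h | h
  · exact Or.inl (Or.inr ⟨hx, h⟩)
  · exact Or.inr h
  · exact Or.inl (Or.inl ⟨hx, h⟩)

/-- A piecewise linear function whose slopes do not increase lies below its initial tangent. -/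
theorem le_right_tangent (h : PLOn φ a b)
    (hc : ∀ t, a < t → t < b → rightSlope φ t + leftSlope φ t ≤ 0) {k : ℤ}
    (hk : HasRightSlope φ a k) {u : ℝ} (h1 : a ≤ u) (h2 : u ≤ b) :
    φ u ≤ φ a + k * (u - a) := by
  by_contra! hlt
  have hau : a < u := h1.lt_of_ne (by rintro rfl; simp at hlt)
  -- Tilting the tangent by a small ε forces the minimum of the difference into the interior of the
  -- interval. The bound ε < 1 is for the integrality argument at the end.
  obtain ⟨ε, hε0, hε1, hε⟩ : ∃ ε : ℝ, 0 < ε ∧ ε < 1 ∧ φ a + k * (u - a) + ε * (u - a) < φ u := by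
    have hδ : 0 < (φ u - (φ a + k * (u - a))) / (u - a) :=
      div_pos (by linarith) (by linarith)
    obtain ⟨ε, hε0, hε1⟩ := exists_between (lt_min hδ one_pos)
    refine ⟨ε, hε0, hε1.trans_le (min_le_right _ _), ?_⟩
    have := (lt_div_iff₀ (sub_pos.2 hau)).1 (hε1.trans_le (min_le_left _ _))
    linarith
  set χ : ℝ → ℝ := fun t => φ t - (k + ε) * (t - a) with hχ
  have hcont : ContinuousOn χ (Set.Icc a u) :=
    (h.continuousOn.mono (Set.Icc_subset_Icc_right h2)).sub (by fun_prop)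
  obtain ⟨t, ht, hmin⟩ := isCompact_Icc.exists_isMinOn (Set.nonempty_Icc.2 h1) hcont
  have hmin : ∀ y ∈ Set.Icc a u, χ t ≤ χ y := fun y hy => hmin hy
  have hta : t ≠ a := by
    rintro rfl
    obtain ⟨y, hy, hy'⟩ := (hk.and (Ioo_mem_nhdsGT hau)).exists
    have := hmin y ⟨hy'.1.le, hy'.2.le⟩
    simp only [hχ, hy] at this
    nlinarith [hy'.1]
  have htu : t ≠ u := by
    rintro rfl
    have := hmin a ⟨le_rfl, h1⟩
    simp only [hχ] at this
    linarith
  have hat : a < t := ht.1.lt_of_ne' hta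
  have htu : t < u := ht.2.lt_of_ne htu
  have hR := h.right hat.le (htu.trans_le h2)
  have hL := h.left hat (htu.le.trans h2)
  have hRL := hc t hat (htu.trans_le h2)
  obtain ⟨y, hy, hy'⟩ := (hR.and (Ioo_mem_nhdsGT htu)).exists
  obtain ⟨z, hz, hz'⟩ := (hL.and (Ioo_mem_nhdsLT hat)).exists
  have e1 := hmin y ⟨hat.le.trans hy'.1.le, hy'.2.le⟩
  have e2 := hmin z ⟨hz'.1.le, hz'.2.le.trans htu.le⟩
  simp only [hχ, hy, hz] at e1 e2
  have f1 : (k : ℝ) + ε ≤ rightSlope φ t := by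
    by_contra! hcon
    nlinarith [mul_pos (sub_pos.2 hcon) (sub_pos.2 hy'.1)]
  have f2 : 0 ≤ (leftSlope φ t : ℝ) + k + ε := by
    by_contra! hcon
    nlinarith [mul_pos (neg_pos.2 hcon) (sub_pos.2 hz'.2)]
  -- Integrality: a slope at least k + ε is at least k + 1, and one at least -k - ε exceeds -k - 1,
  -- so is at least -k. Their sum is positive, against concavity at `t`.
  have g1 : k + 1 ≤ rightSlope φ t := by
    have : (k : ℝ) < rightSlope φ t := by linarith
    exact_mod_cast this
  have g2 : -k ≤ leftSlope φ t := by
    have : (-k - 1 : ℝ) < leftSlope φ t := by linarith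
    have : -k - 1 < leftSlope φ t := by exact_mod_cast this
    omega
  omega

theorem leftSlope_comp_const_sub (h : PLOn φ a b) {t : ℝ} (h1 : a < t) (h2 : t ≤ b) :
    leftSlope (fun u => φ (a + b - u)) t = rightSlope φ (a + b - t) :=
  (h.right (t := a + b - t) (by linarith) (by linarith)).comp_const_sub.leftSlope_eq

theorem rightSlope_comp_const_sub (h : PLOn φ a b) {t : ℝ} (h1 : a ≤ t) (h2 : t < b) :
    rightSlope (fun u => φ (a + b - u)) t = leftSlope φ (a + b - t) :=
  (h.left (t := a + b - t) (by linarith) (by linarith)).comp_const_sub.rightSlope_eq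

theorem le_left_tangent (h : PLOn φ a b)
    (hc : ∀ t, a < t → t < b → rightSlope φ t + leftSlope φ t ≤ 0) {k : ℤ}
    (hk : HasLeftSlope φ b k) {u : ℝ} (h1 : a ≤ u) (h2 : u ≤ b) :
    φ u ≤ φ b + k * (b - u) := by
  have := h.comp_const_sub.le_right_tangent (k := k) (u := a + b - u) (fun t h3 h4 => ?_) ?_
    (by linarith) (by linarith)
  · simp only [sub_sub_cancel, add_sub_cancel_left] at this
    refine this.trans (le_of_eq (by ring))
  · rw [h.leftSlope_comp_const_sub h3 h4.le, h.rightSlope_comp_const_sub h3.le h4, add_comm]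
    exact hc _ (by linarith) (by linarith)
  · exact HasLeftSlope.comp_const_sub (by simpa using hk)

/-- A piecewise linear function without breaks is affine. -/
theorem eq_right_tangent (h : PLOn φ a b)
    (hc : ∀ t, a < t → t < b → rightSlope φ t + leftSlope φ t = 0) {k : ℤ}
    (hk : HasRightSlope φ a k) {u : ℝ} (h1 : a ≤ u) (h2 : u ≤ b) :
    φ u = φ a + k * (u - a) := by
  refine le_antisymm (h.le_right_tangent (fun t h3 h4 => (hc t h3 h4).le) hk h1 h2) ?_
  have h5 := h.neg.le_right_tangent (k := -k) (u := u) (fun t h3 h4 => ?_)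
    (by simpa using hk.int_mul (-1)) h1 h2
  · push_cast at h5; linarith
  · have e1 : HasRightSlope (fun u => -φ u) t (-rightSlope φ t) := by
      simpa using (h.right h3.le h4).int_mul (-1)
    have e2 : HasLeftSlope (fun u => -φ u) t (-leftSlope φ t) := by
      simpa using (h.left h3 h4.le).int_mul (-1)
    rw [e1.rightSlope_eq, e2.leftSlope_eq]
    have := hc t h3 h4
    omega

/-- The outgoing slopes at the ends of a concave piecewise linear function. -/
theorem slopes_nonneg (h : PLOn φ a b) (hab : a < b)
    (hc : ∀ t, a < t → t < b → rightSlope φ t + leftSlope φ t ≤ 0) :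
    0 ≤ rightSlope φ a + leftSlope φ b := by
  have h1 := h.le_right_tangent hc (h.right le_rfl hab) hab.le le_rfl
  have h2 := h.le_left_tangent hc (h.left hab le_rfl) le_rfl hab.le
  have h3 : 0 ≤ ((rightSlope φ a + leftSlope φ b : ℤ) : ℝ) * (b - a) := by
    push_cast; linarith
  have := nonneg_of_mul_nonneg_left h3 (sub_pos.2 hab)
  exact_mod_cast this

/-- A concave piecewise linear function is bounded below by the smaller of its end values. -/
theorem min_le (h : PLOn φ a b)
    (hc : ∀ t, a < t → t < b → rightSlope φ t + leftSlope φ t ≤ 0) {u : ℝ} (h1 : a ≤ u)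
    (h2 : u ≤ b) : min (φ a) (φ b) ≤ φ u := by
  rcases h1.eq_or_lt with rfl | h3
  · exact min_le_left _ _
  rcases h2.eq_or_lt with rfl | h4
  · exact min_le_right _ _
  have e1 := (h.mono h1 le_rfl).le_right_tangent
    (fun t h5 h6 => hc t (h3.trans h5) h6) (h.right h1 h4) h2 le_rfl
  have e2 := (h.mono le_rfl h2).le_left_tangent
    (fun t h5 h6 => hc t h5 (h6.trans h4)) (h.left h3 h2) le_rfl h1
  have e3 := hc u h3 h4
  -- One of the two outgoing slopes at `u` is nonpositive; the tangent in that direction bounds an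
  -- end value by `φ u`.
  rcases le_or_gt (rightSlope φ u) 0 with h5 | h5
  · have h5 : (rightSlope φ u : ℝ) ≤ 0 := by exact_mod_cast h5
    exact (min_le_right _ _).trans (by nlinarith)
  · have h5 : leftSlope φ u ≤ 0 := by omega
    have h5 : (leftSlope φ u : ℝ) ≤ 0 := by exact_mod_cast h5
    exact (min_le_left _ _).trans (by nlinarith)

end PLOn

/-! ### Principal divisors and degrees -/

namespace MetricGraph

variable {V E : Type} {G : MetricGraph V E}

theorem pt_of_mem (e : E) {t : ℝ} (h : t ∈ Set.Ioo 0 (G.len e)) :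
    G.pt e t = Sum.inr ⟨e, ⟨t, h⟩⟩ := dif_pos h

@[simp] theorem pt_zero (e : E) : G.pt e 0 = G.vert (G.src e) := by
  simp [pt]

@[simp] theorem pt_len (e : E) : G.pt e (G.len e) = G.vert (G.tgt e) := by
  simp [pt, (G.len_pos e).not_ge]

theorem IsPL.plOn {f : G.Point → ℝ} (hf : G.IsPL f) (e : E) :
    PLOn (fun u => f (G.pt e u)) 0 (G.len e) := fun t => hf e t

theorem isPL_const (a : ℝ) : G.IsPL fun _ => a :=
  fun _ _ => ⟨fun _ _ => ⟨0, hasRightSlope_const _ _⟩, fun _ _ => ⟨0, hasLeftSlope_const _ _⟩⟩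

theorem IsPL.add {f f' : G.Point → ℝ} (hf : G.IsPL f) (hf' : G.IsPL f') :
    G.IsPL fun x => f x + f' x :=
  fun e _ => ⟨fun h1 h2 => ⟨_, ((hf.plOn e).right h1 h2).add ((hf'.plOn e).right h1 h2)⟩,
    fun h1 h2 => ⟨_, ((hf.plOn e).left h1 h2).add ((hf'.plOn e).left h1 h2)⟩⟩

theorem IsPL.int_mul {f : G.Point → ℝ} (hf : G.IsPL f) (a : ℤ) : G.IsPL fun x => a * f x :=
  fun e _ => ⟨fun h1 h2 => ⟨_, ((hf.plOn e).right h1 h2).int_mul a⟩,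
    fun h1 h2 => ⟨_, ((hf.plOn e).left h1 h2).int_mul a⟩⟩

theorem degree_add (A B : G.Divisor) : degree (A + B) = degree A + degree B :=
  Finsupp.sum_add_index' (fun _ => rfl) fun _ _ _ => rfl

theorem degree_single (x : G.Point) (a : ℤ) : degree (G := G) (Finsupp.single x a) = a :=
  Finsupp.sum_single_index rfl

theorem degree_neg (A : G.Divisor) : degree (-A) = -degree A := by
  have h := degree_add A (-A)
  have h0 : degree (0 : G.Divisor) = 0 := Finsupp.sum_zero_index
  rw [add_neg_cancel, h0] at h
  omega

theorem degree_sub (A B : G.Divisor) : degree (A - B) = degree A - degree B := by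
  rw [sub_eq_add_neg, degree_add, degree_neg, sub_eq_add_neg]

variable [Fintype E]

theorem ord_const (a : ℝ) (x : G.Point) : G.ord (fun _ => a) x = 0 := by
  rcases x with x | ⟨e, t⟩ <;>
  simp [ord, (hasRightSlope_const a _).rightSlope_eq, (hasLeftSlope_const a _).leftSlope_eq]

/-- The chosen slopes are meaningful only where slopes exist; piecewise linearity guarantees this in
every direction entering `ord`. -/
theorem IsPL.ord_add {f f' : G.Point → ℝ} (hf : G.IsPL f) (hf' : G.IsPL f') (x : G.Point) :
    G.ord (fun x => f x + f' x) x = G.ord f x + G.ord f' x := by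
  have hR : ∀ e t, 0 ≤ t → t < G.len e → rightSlope (fun u => f (G.pt e u) + f' (G.pt e u)) t =
      rightSlope (fun u => f (G.pt e u)) t + rightSlope (fun u => f' (G.pt e u)) t :=
    fun e t h1 h2 => (((hf.plOn e).right h1 h2).add ((hf'.plOn e).right h1 h2)).rightSlope_eq
  have hL : ∀ e t, 0 < t → t ≤ G.len e → leftSlope (fun u => f (G.pt e u) + f' (G.pt e u)) t =
      leftSlope (fun u => f (G.pt e u)) t + leftSlope (fun u => f' (G.pt e u)) t :=
    fun e t h1 h2 => (((hf.plOn e).left h1 h2).add ((hf'.plOn e).left h1 h2)).leftSlope_eq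
  rcases x with x | ⟨e, t⟩
  · simp only [ord, hR _ 0 le_rfl (G.len_pos _), hL _ _ (G.len_pos _) le_rfl]
    simp only [← Finset.sum_filter, Finset.sum_add_distrib]
    ring
  · simp only [ord, hR e t t.2.1.le t.2.2, hL e t t.2.1 t.2.2.le]
    ring

theorem IsPL.ord_int_mul {f : G.Point → ℝ} (hf : G.IsPL f) (a : ℤ) (x : G.Point) :
    G.ord (fun x => a * f x) x = a * G.ord f x := by
  have hR : ∀ e t, 0 ≤ t → t < G.len e → rightSlope (fun u => a * f (G.pt e u)) t =
      a * rightSlope (fun u => f (G.pt e u)) t :=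
    fun e t h1 h2 => (((hf.plOn e).right h1 h2).int_mul a).rightSlope_eq
  have hL : ∀ e t, 0 < t → t ≤ G.len e → leftSlope (fun u => a * f (G.pt e u)) t =
      a * leftSlope (fun u => f (G.pt e u)) t :=
    fun e t h1 h2 => (((hf.plOn e).left h1 h2).int_mul a).leftSlope_eq
  rcases x with x | ⟨e, t⟩
  · simp only [ord, hR _ 0 le_rfl (G.len_pos _), hL _ _ (G.len_pos _) le_rfl]
    simp only [← Finset.sum_filter, ← Finset.mul_sum]
    ring
  · simp only [ord, hR e t t.2.1.le t.2.2, hL e t t.2.1 t.2.2.le]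
    ring

/-! ### Linear equivalence -/

theorem Moves.add {f f' : G.Point → ℝ} {A A' B B' : G.Divisor} (h : G.Moves f A A')
    (h' : G.Moves f' B B') : G.Moves (fun x => f x + f' x) (A + B) (A' + B') :=
  ⟨h.1.add h'.1, fun x => by
    rw [h.1.ord_add h'.1, Finsupp.add_apply, Finsupp.add_apply, h.2, h'.2]; ring⟩

theorem Moves.trans {f f' : G.Point → ℝ} {A B C : G.Divisor} (h : G.Moves f A B)
    (h' : G.Moves f' B C) : G.Moves (fun x => f x + f' x) A C :=
  ⟨h.1.add h'.1, fun x => by rw [h.1.ord_add h'.1, h'.2, h.2]; ring⟩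

theorem Moves.int_mul {f : G.Point → ℝ} {A B : G.Divisor} (h : G.Moves f A B) (a : ℤ) :
    G.Moves (fun x => a * f x) (a • A) (a • B) :=
  ⟨h.1.int_mul a, fun x => by
    rw [h.1.ord_int_mul, Finsupp.smul_apply, Finsupp.smul_apply, h.2, smul_eq_mul, smul_eq_mul]
    ring⟩

theorem moves_const (a : ℝ) (A : G.Divisor) : G.Moves (fun _ => a) A A :=
  ⟨isPL_const a, fun x => by rw [ord_const, add_zero]⟩

theorem Moves.add_const {f : G.Point → ℝ} {A B : G.Divisor} (h : G.Moves f A B) (a : ℝ) :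
    G.Moves (fun x => f x + a) A B := h.trans (moves_const a B)

theorem LinEquiv.refl (A : G.Divisor) : G.LinEquiv A A := ⟨_, moves_const 0 A⟩

theorem LinEquiv.trans {A B C : G.Divisor} (h : G.LinEquiv A B) (h' : G.LinEquiv B C) :
    G.LinEquiv A C :=
  let ⟨_, hf⟩ := h; let ⟨_, hf'⟩ := h'; ⟨_, hf.trans hf'⟩

theorem LinEquiv.add {A A' B B' : G.Divisor} (h : G.LinEquiv A A') (h' : G.LinEquiv B B') :
    G.LinEquiv (A + B) (A' + B') :=
  let ⟨_, hf⟩ := h; let ⟨_, hf'⟩ := h'; ⟨_, hf.add hf'⟩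

theorem LinEquiv.zsmul {A B : G.Divisor} (h : G.LinEquiv A B) (a : ℤ) :
    G.LinEquiv (a • A) (a • B) :=
  let ⟨_, hf⟩ := h; ⟨_, hf.int_mul a⟩

theorem LinEquiv.add_right {A B : G.Divisor} (h : G.LinEquiv A B) (C : G.Divisor) :
    G.LinEquiv (A + C) (B + C) := h.add (.refl C)

theorem LinEquiv.symm {A B : G.Divisor} (h : G.LinEquiv A B) : G.LinEquiv B A := by
  have := (h.zsmul (-1)).add_right (A + B)
  have e1 : (-1 : ℤ) • A + (A + B) = B := by simp
  have e2 : (-1 : ℤ) • B + (A + B) = A := by simp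
  rwa [e1, e2] at this

theorem LinEquiv.of_sub {A B : G.Divisor} (h : G.LinEquiv (A - B) 0) : G.LinEquiv A B := by
  simpa using h.add_right B

end MetricGraph

namespace MetricGraph

/-! ### Subgraphs and wedges -/

/-- An embedding of a metric graph as a subgraph. -/
structure Sub {V E V' E' : Type} (G : MetricGraph V E) (H : MetricGraph V' E') where
  onV : V → V'
  onE : E → E'
  onV_inj : Function.Injective onV
  onE_inj : Function.Injective onE
  src : ∀ e, H.src (onE e) = onV (G.src e)
  tgt : ∀ e, H.tgt (onE e) = onV (G.tgt e)
  len : ∀ e, H.len (onE e) = G.len e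

namespace Sub

variable {V E V' E' : Type} {G : MetricGraph V E} {H : MetricGraph V' E'} (S : Sub G H)

/-- The embedding on points. -/
def map : G.Point → H.Point
  | Sum.inl x => Sum.inl (S.onV x)
  | Sum.inr p => Sum.inr ⟨S.onE p.1, ⟨p.2, by rw [S.len]; exact p.2.2⟩⟩

@[simp] theorem map_vert (x : V) : S.map (G.vert x) = H.vert (S.onV x) := rfl

theorem map_inj : Function.Injective S.map := by
  rintro (x | ⟨e, t, ht⟩) (y | ⟨e', t', ht'⟩) h
  · simp only [map, Sum.inl.injEq] at h
    rw [S.onV_inj h]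
  · simp [map] at h
  · simp [map] at h
  · simp only [map, Sum.inr.injEq, Sigma.mk.injEq] at h
    obtain rfl := S.onE_inj h.1
    simpa using h.2

theorem map_pt (e : E) (t : ℝ) : S.map (G.pt e t) = H.pt (S.onE e) t := by
  by_cases h : t ∈ Set.Ioo 0 (G.len e)
  · have h' : t ∈ Set.Ioo 0 (H.len (S.onE e)) := by rwa [S.len]
    rw [pt_of_mem e h, pt_of_mem _ h']
    rfl
  · have h' : t ∉ Set.Ioo 0 (H.len (S.onE e)) := by rwa [S.len]
    rw [pt, dif_neg h, pt, dif_neg h']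
    split_ifs <;> simp [S.src, S.tgt]

theorem src_eq_iff (e : E) (x : V) : H.src (S.onE e) = S.onV x ↔ G.src e = x := by
  rw [S.src, S.onV_inj.eq_iff]

theorem tgt_eq_iff (e : E) (x : V) : H.tgt (S.onE e) = S.onV x ↔ G.tgt e = x := by
  rw [S.tgt, S.onV_inj.eq_iff]

/-- The image of a divisor on the subgraph. -/
noncomputable def push (A : G.Divisor) : H.Divisor := Finsupp.mapDomain S.map A

theorem push_add (A B : G.Divisor) : S.push (A + B) = S.push A + S.push B :=
  Finsupp.mapDomain_add

theorem push_single (x : G.Point) (a : ℤ) :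
    S.push (Finsupp.single x a) = Finsupp.single (S.map x) a := Finsupp.mapDomain_single

theorem push_map (A : G.Divisor) (x : G.Point) : S.push A (S.map x) = A x :=
  Finsupp.mapDomain_apply S.map_inj _ _

theorem degree_push (A : G.Divisor) : degree (S.push A) = degree A :=
  Finsupp.sum_mapDomain_index (fun _ => rfl) fun _ _ _ => rfl

theorem isPL_comp {f : H.Point → ℝ} (hf : H.IsPL f) : G.IsPL (f ∘ S.map) := by
  intro e t
  have := hf (S.onE e) t
  rw [S.len] at this
  simpa only [Function.comp, S.map_pt] using this

end Sub

/-- The graph `H` is the union of the subgraphs `G₁` and `G₂` which have precisely one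
vertex in common. -/
structure Wedge {V₁ E₁ V₂ E₂ V E : Type} [Fintype E₁] [Fintype E₂] [Fintype E]
    (G₁ : MetricGraph V₁ E₁) (G₂ : MetricGraph V₂ E₂) (H : MetricGraph V E)
    (b₁ : V₁) (b₂ : V₂) where
  left : Sub G₁ H
  right : Sub G₂ H
  vert_eq_iff : ∀ x y, left.onV x = right.onV y ↔ x = b₁ ∧ y = b₂
  edge_ne : ∀ e e', left.onE e ≠ right.onE e'
  cover_vert : ∀ z, (∃ x, left.onV x = z) ∨ ∃ y, right.onV y = z
  cover_edge : ∀ z, (∃ x, left.onE x = z) ∨ ∃ y, right.onE y = z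
  sum_eq : ∀ F : E → ℤ, ∑ e, F e = ∑ e, F (left.onE e) + ∑ e, F (right.onE e)

namespace Wedge

variable {V₁ E₁ V₂ E₂ V E : Type} [Fintype E₁] [Fintype E₂] [Fintype E]
    {G₁ : MetricGraph V₁ E₁} {G₂ : MetricGraph V₂ E₂} {H : MetricGraph V E}
    {b₁ : V₁} {b₂ : V₂} (W : Wedge G₁ G₂ H b₁ b₂)

/-- The wedge with its two parts exchanged. -/
def symm : Wedge G₂ G₁ H b₂ b₁ where
  left := W.right
  right := W.left
  vert_eq_iff x y := by rw [eq_comm, W.vert_eq_iff, and_comm]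
  edge_ne e e' := (W.edge_ne e' e).symm
  cover_vert z := (W.cover_vert z).symm
  cover_edge z := (W.cover_edge z).symm
  sum_eq F := by rw [W.sum_eq, add_comm]

theorem onV_base : W.left.onV b₁ = W.right.onV b₂ := (W.vert_eq_iff _ _).2 ⟨rfl, rfl⟩

theorem map_base : W.left.map (G₁.vert b₁) = W.right.map (G₂.vert b₂) :=
  congrArg Sum.inl W.onV_base

theorem map_eq_iff (x : G₁.Point) (y : G₂.Point) :
    W.left.map x = W.right.map y ↔ x = G₁.vert b₁ ∧ y = G₂.vert b₂ := by
  rcases x with x | ⟨e, t⟩ <;> rcases y with y | ⟨e', t'⟩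
  · simp [Sub.map, W.vert_eq_iff, vert]
  · simp [Sub.map, vert]
  · simp [Sub.map, vert]
  · simp [Sub.map, vert, W.edge_ne]

theorem cover (z : H.Point) : (∃ x, W.left.map x = z) ∨ ∃ y, W.right.map y = z := by
  rcases z with z | ⟨e, t, ht⟩
  · rcases W.cover_vert z with ⟨x, rfl⟩ | ⟨y, rfl⟩
    · exact Or.inl ⟨G₁.vert x, rfl⟩
    · exact Or.inr ⟨G₂.vert y, rfl⟩
  · rcases W.cover_edge e with ⟨x, rfl⟩ | ⟨y, rfl⟩
    · exact Or.inl ⟨Sum.inr ⟨x, ⟨t, by rwa [← W.left.len]⟩⟩, rfl⟩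
    · exact Or.inr ⟨Sum.inr ⟨y, ⟨t, by rwa [← W.right.len]⟩⟩, rfl⟩

theorem push_right_left (B : G₂.Divisor) {x : G₁.Point} (hx : x ≠ G₁.vert b₁) :
    W.right.push B (W.left.map x) = 0 :=
  Finsupp.mapDomain_of_notMem_range _ _ fun ⟨y, hy⟩ => hx ((W.map_eq_iff x y).1 hy.symm).1

theorem push_right_base (B : G₂.Divisor) :
    W.right.push B (W.left.map (G₁.vert b₁)) = B (G₂.vert b₂) := by
  rw [W.map_base, W.right.push_map]

theorem push_left_right (A : G₁.Divisor) {y : G₂.Point} (hy : y ≠ G₂.vert b₂) :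
    W.left.push A (W.right.map y) = 0 := W.symm.push_right_left A hy

theorem push_left_base (A : G₁.Divisor) :
    W.left.push A (W.right.map (G₂.vert b₂)) = A (G₁.vert b₁) := W.symm.push_right_base A

theorem isPL {f : H.Point → ℝ} (h₁ : G₁.IsPL (f ∘ W.left.map)) (h₂ : G₂.IsPL (f ∘ W.right.map)) :
    H.IsPL f := by
  intro e t
  rcases W.cover_edge e with ⟨e, rfl⟩ | ⟨e, rfl⟩
  · have := h₁ e t
    rw [W.left.len]
    simpa only [Function.comp, W.left.map_pt] using this
  · have := h₂ e t
    rw [W.right.len]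
    simpa only [Function.comp, W.right.map_pt] using this

/-- Away from the common vertex, every direction at a point of the left part stays in the left part.
-/
theorem ord_left (f : H.Point → ℝ) {x : G₁.Point} (hx : x ≠ G₁.vert b₁) :
    H.ord f (W.left.map x) = G₁.ord (f ∘ W.left.map) x := by
  rcases x with x | ⟨e, t⟩
  · have hx : x ≠ b₁ := fun h => hx (by rw [h])
    have h : ∀ y, W.right.onV y ≠ W.left.onV x := fun y hy =>
      hx ((W.vert_eq_iff _ _).1 hy.symm).1
    have hs : ∀ e, H.src (W.right.onE e) ≠ W.left.onV x := fun e => by rw [W.right.src]; exact h _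
    have ht : ∀ e, H.tgt (W.right.onE e) ≠ W.left.onV x := fun e => by rw [W.right.tgt]; exact h _
    change H.ord f (Sum.inl (W.left.onV x)) = _
    simp only [ord, W.sum_eq, hs, ht, W.left.len, if_false, Finset.sum_const_zero, add_zero,
      Function.comp_apply, W.left.map_pt]
    congr! 5
    exacts [W.left.src_eq_iff _ x, W.left.tgt_eq_iff _ x]
  · change -(_ + _) = _
    simp only [ord, Function.comp_apply, W.left.map_pt]

theorem ord_right (f : H.Point → ℝ) {y : G₂.Point} (hy : y ≠ G₂.vert b₂) :
    H.ord f (W.right.map y) = G₂.ord (f ∘ W.right.map) y := W.symm.ord_left f hy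

/-- The directions at the common vertex are the disjoint union of those in the two parts. -/
theorem ord_base (f : H.Point → ℝ) :
    H.ord f (W.left.map (G₁.vert b₁)) =
      G₁.ord (f ∘ W.left.map) (G₁.vert b₁) + G₂.ord (f ∘ W.right.map) (G₂.vert b₂) := by
  have hs : ∀ e, H.src (W.right.onE e) = W.left.onV b₁ ↔ G₂.src e = b₂ := fun e => by
    rw [W.onV_base, W.right.src_eq_iff]
  have ht : ∀ e, H.tgt (W.right.onE e) = W.left.onV b₁ ↔ G₂.tgt e = b₂ := fun e => by
    rw [W.onV_base, W.right.tgt_eq_iff]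
  change H.ord f (Sum.inl (W.left.onV b₁)) = _
  simp only [ord, W.sum_eq, W.left.len, W.right.len, Function.comp_apply, W.left.map_pt,
    W.right.map_pt]
  rw [← neg_add, add_add_add_comm]
  congr! 6
  exacts [W.left.src_eq_iff _ b₁, W.left.tgt_eq_iff _ b₁, hs _, ht _]

open Classical in
/-- The function on the wedge that is given by `f₁` and `f₂` on its two parts. -/
noncomputable def glue (f₁ : G₁.Point → ℝ) (f₂ : G₂.Point → ℝ) (z : H.Point) : ℝ :=
  if h : ∃ x, W.left.map x = z then f₁ h.choose
  else if h : ∃ y, W.right.map y = z then f₂ h.choose else 0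

theorem glue_left (f₁ : G₁.Point → ℝ) (f₂ : G₂.Point → ℝ) :
    W.glue f₁ f₂ ∘ W.left.map = f₁ := by
  funext x
  have h : ∃ x', W.left.map x' = W.left.map x := ⟨x, rfl⟩
  simp only [Function.comp, glue, dif_pos h]
  rw [W.left.map_inj h.choose_spec]

theorem glue_right {f₁ : G₁.Point → ℝ} {f₂ : G₂.Point → ℝ}
    (hb : f₁ (G₁.vert b₁) = f₂ (G₂.vert b₂)) : W.glue f₁ f₂ ∘ W.right.map = f₂ := by
  funext y
  by_cases h : ∃ x, W.left.map x = W.right.map y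
  · obtain ⟨x, hx⟩ := id h
    have h1 := (W.map_eq_iff _ _).1 h.choose_spec
    simp only [Function.comp, glue, dif_pos h]
    rw [h1.1, h1.2, hb]
  · have h' : ∃ y', W.right.map y' = W.right.map y := ⟨y, rfl⟩
    simp only [Function.comp, glue, dif_neg h, dif_pos h']
    rw [W.right.map_inj h'.choose_spec]

/-- Equality of the values at the common vertex is the only compatibility needed: there both the
multiplicities and the orders add up. -/
theorem moves_glue {f₁ : G₁.Point → ℝ} {f₂ : G₂.Point → ℝ} {A A' : G₁.Divisor}
    {B B' : G₂.Divisor} (h₁ : G₁.Moves f₁ A A') (h₂ : G₂.Moves f₂ B B')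
    (hb : f₁ (G₁.vert b₁) = f₂ (G₂.vert b₂)) :
    H.Moves (W.glue f₁ f₂) (W.left.push A + W.right.push B)
      (W.left.push A' + W.right.push B') := by
  have e1 := W.glue_left f₁ f₂
  have e2 := W.glue_right hb
  refine ⟨W.isPL (by rw [e1]; exact h₁.1) (by rw [e2]; exact h₂.1), fun z => ?_⟩
  rcases W.cover z with ⟨x, rfl⟩ | ⟨y, rfl⟩
  · by_cases hx : x = G₁.vert b₁
    · subst hx
      simp only [Finsupp.add_apply, W.ord_base, e1, e2, Sub.push_map, W.push_right_base, h₁.2, h₂.2]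
      ring
    · simp only [Finsupp.add_apply, W.ord_left _ hx, e1, Sub.push_map, W.push_right_left _ hx, h₁.2,
        add_zero]
  · by_cases hy : y = G₂.vert b₂
    · subst hy
      rw [← W.map_base]
      simp only [Finsupp.add_apply, W.ord_base, e1, e2, Sub.push_map, W.push_right_base, h₁.2, h₂.2]
      ring
    · simp only [Finsupp.add_apply, W.ord_right _ hy, e2, Sub.push_map, W.push_left_right _ hy, h₂.2,
        zero_add]

/-- Every function that moves a divisor on `G₁` extends over `G₂`, given a linear equivalence
there. -/
theorem exists_moves {f₁ : G₁.Point → ℝ} {A A' : G₁.Divisor} {B B' : G₂.Divisor}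
    (h₁ : G₁.Moves f₁ A A') (h₂ : G₂.LinEquiv B B') :
    ∃ f, f ∘ W.left.map = f₁ ∧
      H.Moves f (W.left.push A + W.right.push B) (W.left.push A' + W.right.push B') := by
  obtain ⟨f₂, hf₂⟩ := h₂
  exact ⟨_, W.glue_left _ _, W.moves_glue h₁
    (hf₂.add_const (f₁ (G₁.vert b₁) - f₂ (G₂.vert b₂))) (by ring)⟩

theorem linEquiv {A A' : G₁.Divisor} {B B' : G₂.Divisor} (h₁ : G₁.LinEquiv A A')
    (h₂ : G₂.LinEquiv B B') :
    H.LinEquiv (W.left.push A + W.right.push B) (W.left.push A' + W.right.push B') :=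
  let ⟨_, hf⟩ := h₁
  let ⟨f, _, h⟩ := W.exists_moves hf h₂
  ⟨f, h⟩

/-- Chips at the common vertex may be booked on either part; this is how multiplicities pass from
one part to the next. -/
theorem push_base (a : ℤ) : W.left.push (Finsupp.single (G₁.vert b₁) a) =
    W.right.push (Finsupp.single (G₂.vert b₂) a) := by
  rw [Sub.push_single, Sub.push_single, W.map_base]

/-- Every divisor on the wedge is a sum of divisors on the two parts; the multiplicity at the
common vertex can be assigned to the second one. -/
theorem exists_push_add (F : H.Divisor) : ∃ (A : G₁.Divisor) (B : G₂.Divisor),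
    F = W.left.push A + W.right.push B ∧ A (G₁.vert b₁) = 0 ∧
    (∀ x, x ≠ G₁.vert b₁ → A x = F (W.left.map x)) ∧ ∀ y, B y = F (W.right.map y) := by
  classical
  refine ⟨(F.comapDomain W.left.map W.left.map_inj.injOn).erase (G₁.vert b₁),
    F.comapDomain W.right.map W.right.map_inj.injOn, ?_, by simp, fun x hx => ?_, fun y => rfl⟩
  · ext z
    rcases W.cover z with ⟨x, rfl⟩ | ⟨y, rfl⟩
    · by_cases hx : x = G₁.vert b₁
      · subst hx
        rw [Finsupp.add_apply, Sub.push_map, W.push_right_base, Finsupp.erase_same, zero_add,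
          Finsupp.comapDomain_apply, W.map_base]
      · simp only [Finsupp.add_apply, Sub.push_map, W.push_right_left _ hx, Finsupp.erase_ne hx,
          Finsupp.comapDomain_apply, add_zero]
    · by_cases hy : y = G₂.vert b₂
      · subst hy
        simp only [Finsupp.add_apply, Sub.push_map, W.push_left_base, Finsupp.erase_same, zero_add,
          Finsupp.comapDomain_apply]
      · simp only [Finsupp.add_apply, Sub.push_map, W.push_left_right _ hy, zero_add,
          Finsupp.comapDomain_apply]
  · simp only [Finsupp.erase_ne hx, Finsupp.comapDomain_apply]

end Wedge

/-! ### Vertex avoiding series -/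

/-- The divisor `D` with equivalent divisors `Di i = D + div (φ i)` and multiplicities `c i`
behaves like a vertex avoiding divisor of rank `r` with respect to `x` and `y`, except that the
multiplicity of `Di i` at `y` is `c i` (possibly negative) rather than `r - i`. -/
structure Series {V E : Type} [Fintype E] (G : MetricGraph V E) (x y : V) (r : ℕ)
    (D : G.Divisor) (c : Fin (r + 1) → ℤ) (Di : Fin (r + 1) → G.Divisor)
    (φ : Fin (r + 1) → G.Point → ℝ) : Prop where
  moves : ∀ i : Fin (r + 1), G.Moves (φ i) D (Di i)
  nonneg : ∀ (i : Fin (r + 1)) p, p ≠ G.vert y → 0 ≤ Di i p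
  verts : ∀ (i : Fin (r + 1)) z, Di i (G.vert z) =
    (Finsupp.single (G.vert x) (i : ℤ) + Finsupp.single (G.vert y) (c i) : G.Divisor) (G.vert z)
  unique : ∀ (i : Fin (r + 1)) F, G.LinEquiv D F → (∀ p, p ≠ G.vert y → 0 ≤ F p) → (i : ℤ) ≤ F (G.vert x) →
    c i ≤ F (G.vert y) → F = Di i
  rank : ∀ (t : Fin (r + 1)) (F : G.Divisor), 0 ≤ F → degree F = t → ∃ F', G.LinEquiv D F' ∧
    (∀ p, p ≠ G.vert y → F p ≤ F' p) ∧ c t ≤ F' (G.vert y)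

/-- Effectivity is never demanded at `y`, so chips may be added or removed there freely, with the
same functions. As `x` differs from `y`, the conditions at `x` are unaffected. -/
theorem Series.add_single {V E : Type} [Fintype E] {G : MetricGraph V E} {x y : V} {r : ℕ}
    {D : G.Divisor} {c : Fin (r + 1) → ℤ} {Di : Fin (r + 1) → G.Divisor}
    {φ : Fin (r + 1) → G.Point → ℝ} (h : G.Series x y r D c Di φ) (hxy : x ≠ y) (k : ℤ) :
    G.Series x y r (D + Finsupp.single (G.vert y) k) (fun i => c i + k)
      (fun i => Di i + Finsupp.single (G.vert y) k) φ where
  moves i := by simpa using (h.moves i).add (moves_const 0 (Finsupp.single (G.vert y) k))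
  nonneg i p hp := by simpa [Finsupp.single_eq_of_ne hp] using h.nonneg i p hp
  verts i z := by
    simp only [Finsupp.add_apply, h.verts i z, Finsupp.single_add, add_assoc]
  unique i F h1 h2 h3 h4 := by
    have hx : G.vert x ≠ G.vert y := fun e => hxy (Sum.inl_injective e)
    have := h.unique i (F - Finsupp.single (G.vert y) k) ?_ ?_ ?_ ?_
    · rw [← this, sub_add_cancel]
    · simpa [sub_eq_add_neg] using h1.add_right (-Finsupp.single (G.vert y) k)
    · intro p hp
      simpa [Finsupp.single_eq_of_ne hp] using h2 p hp
    · simpa [Finsupp.single_eq_of_ne hx] using h3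
    · simp only [Finsupp.sub_apply, Finsupp.single_eq_same]; omega
  rank t F h1 h2 := by
    obtain ⟨F', h3, h4, h5⟩ := h.rank t F h1 h2
    refine ⟨F' + Finsupp.single (G.vert y) k, h3.add_right _, fun p hp => ?_, ?_⟩
    · simpa [Finsupp.single_eq_of_ne hp] using h4 p hp
    · simpa using h5

/-! ### Continuing a series over a wedge -/

namespace Wedge

variable {V₁ E₁ V₂ E₂ V E : Type} [Fintype E₁] [Fintype E₂] [Fintype E]
    {G₁ : MetricGraph V₁ E₁} {G₂ : MetricGraph V₂ E₂} {H : MetricGraph V E}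
    {b₁ : V₁} {b₂ : V₂} (W : Wedge G₁ G₂ H b₁ b₂)

/-- Vertex avoiding series can be continued over suitable graphs `G₂`. -/
theorem exists_series {x : V₁} {t : V₂} {r : ℕ} {D : G₁.Divisor} {c c' : Fin (r + 1) → ℤ}
    {Di : Fin (r + 1) → G₁.Divisor} {φ : Fin (r + 1) → G₁.Point → ℝ}
    (h : G₁.Series x b₁ r D c Di φ) (hx : x ≠ b₁) (ht : t ≠ b₂)
    (p : G₂.Point) (Q : Fin (r + 1) → G₂.Divisor)
    (hQ : ∀ i, 0 ≤ Q i) (hQv : ∀ i z, Q i (G₂.vert z) = 0)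
    (hQp : ∀ i, G₂.LinEquiv (Finsupp.single (G₂.vert b₂) (c i) + Finsupp.single p 1)
      (Q i + Finsupp.single (G₂.vert t) (c' i)))
    (hrigid : ∀ i f, G₂.IsPL f → (∀ y, 0 ≤ Q i y + G₂.ord f y) → ∀ y, G₂.ord f y = 0)
    (heff : ∀ A : G₂.Divisor, 1 ≤ degree A → ∃ B, 0 ≤ B ∧ G₂.LinEquiv A B)
    (hc : ∀ i j : Fin (r + 1), i < j → c' j + ((j : ℤ) - i) ≤ c i) :
    ∃ Di' φ', H.Series (W.left.onV x) (W.right.onV t) r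
      (W.left.push D + Finsupp.single (W.right.map p) 1) c' Di' φ' ∧
      ∀ i, φ' i ∘ W.left.map = φ i := by
  -- Booking `a` chips of the common vertex on the right part. With `a = c i` this removes all chips
  -- of `Di i` there from the left part.
  have hpush : ∀ (A : G₁.Divisor) (a : ℤ) (B : G₂.Divisor), W.left.push A + W.right.push B =
      W.left.push (A + Finsupp.single (G₁.vert b₁) (-a)) +
        W.right.push (Finsupp.single (G₂.vert b₂) a + B) := by
    intro A a B
    rw [W.left.push_add, W.right.push_add, W.push_base, add_assoc, ← add_assoc (W.right.push _),
      ← W.right.push_add, ← Finsupp.single_add, neg_add_cancel, Finsupp.single_zero]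
    simp [Sub.push]
  have hD : W.left.push D + Finsupp.single (W.right.map p) 1 =
      W.left.push D + W.right.push (Finsupp.single p 1) := by rw [Sub.push_single]
  rw [hD]
  have hex : ∀ i, ∃ f, f ∘ W.left.map = φ i ∧
      H.Moves f (W.left.push D + W.right.push (Finsupp.single p 1))
        (W.left.push (Di i + Finsupp.single (G₁.vert b₁) (-c i)) +
          W.right.push (Q i + Finsupp.single (G₂.vert t) (c' i))) := by
    intro i
    rw [hpush D (c i)]
    refine W.exists_moves ?_ (hQp i)
    simpa using (h.moves i).add (moves_const 0 (Finsupp.single (G₁.vert b₁) (-c i)))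
  choose φ' hφ' hmoves using hex
  have htv : G₂.vert t ≠ G₂.vert b₂ := fun e => ht (Sum.inl_injective e)
  have hxv : G₁.vert x ≠ G₁.vert b₁ := fun e => hx (Sum.inl_injective e)
  have hbase : ∀ i, (Di i + Finsupp.single (G₁.vert b₁) (-c i)) (G₁.vert b₁) = 0 := by
    intro i
    rw [Finsupp.add_apply, h.verts]
    simp [Finsupp.single_eq_of_ne hxv.symm]
  have htip : H.vert (W.right.onV t) = W.right.map (G₂.vert t) := rfl
  have hroot : H.vert (W.left.onV x) = W.left.map (G₁.vert x) := rfl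
  have htl : ∀ y, W.left.map y ≠ W.right.map (G₂.vert t) := fun y e =>
    htv ((W.map_eq_iff _ _).1 e).2
  have hxr : ∀ y, W.right.map y ≠ W.left.map (G₁.vert x) := fun y e =>
    hxv ((W.map_eq_iff _ _).1 e.symm).1
  -- values of the new divisors on the two parts
  have hvl : ∀ i y, y ≠ G₁.vert b₁ →
      (W.left.push (Di i + Finsupp.single (G₁.vert b₁) (-c i)) +
        W.right.push (Q i + Finsupp.single (G₂.vert t) (c' i))) (W.left.map y) = Di i y := by
    intro i y hy
    rw [Finsupp.add_apply, Sub.push_map, W.push_right_left _ hy, Finsupp.add_apply,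
      Finsupp.single_eq_of_ne hy, add_zero, add_zero]
  have hvr : ∀ i y,
      (W.left.push (Di i + Finsupp.single (G₁.vert b₁) (-c i)) +
        W.right.push (Q i + Finsupp.single (G₂.vert t) (c' i))) (W.right.map y) =
      Q i y + (Finsupp.single (G₂.vert t) (c' i) : G₂.Divisor) y := by
    intro i y
    rw [Finsupp.add_apply, Sub.push_map, Finsupp.add_apply]
    by_cases hy : y = G₂.vert b₂
    · subst hy; rw [W.push_left_base, hbase, zero_add]
    · rw [W.push_left_right _ hy, zero_add]
  refine ⟨_, φ', ⟨hmoves, ?_, ?_, ?_, ?_⟩, hφ'⟩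
  · intro i z hz
    rw [htip] at hz
    rcases W.cover z with ⟨y, rfl⟩ | ⟨y, rfl⟩
    · by_cases hy : y = G₁.vert b₁
      · subst hy
        rw [W.map_base, hvr, Finsupp.single_eq_of_ne htv.symm, add_zero]
        exact hQ i _
      · rw [hvl i y hy]
        exact h.nonneg i y hy
    · rw [hvr, Finsupp.single_eq_of_ne (fun e => hz (by rw [e])), add_zero]
      exact hQ i _
  · intro i z
    rw [Finsupp.add_apply (Finsupp.single _ _), hroot, htip]
    rcases W.cover_vert z with ⟨y, rfl⟩ | ⟨y, rfl⟩
    · by_cases hy : y = b₁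
      · subst hy
        rw [show H.vert (W.left.onV y) = W.right.map (G₂.vert b₂) from W.map_base, hvr,
          Finsupp.single_eq_of_ne htv.symm, Finsupp.single_eq_of_ne (hxr _),
          Finsupp.single_eq_of_ne (fun e => htv.symm (W.right.map_inj e)), hQv]
      · have hy' : G₁.vert y ≠ G₁.vert b₁ := fun e => hy (Sum.inl_injective e)
        rw [show H.vert (W.left.onV y) = W.left.map (G₁.vert y) from rfl, hvl i _ hy',
          h.verts, Finsupp.add_apply, Finsupp.single_eq_of_ne hy',
          Finsupp.single_eq_of_ne (htl _), ← Sub.push_single, Sub.push_map]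
    · rw [show H.vert (W.right.onV y) = W.right.map (G₂.vert y) from rfl, hvr, hQv,
        Finsupp.single_eq_of_ne (hxr _), ← W.right.push_single (G₂.vert t), Sub.push_map]
  · rintro i F ⟨χ', hχ'⟩ hF hFx hFt
    obtain ⟨χ, hχ⟩ : H.LinEquiv _ F := LinEquiv.trans (LinEquiv.symm ⟨_, hmoves i⟩) ⟨χ', hχ'⟩
    rw [hroot] at hFx
    rw [htip] at hFt hF
    have hl := W.left.isPL_comp hχ.1
    have hr := W.right.isPL_comp hχ.1
    -- If the left order at the common vertex is nonnegative, the restriction of `χ` to the left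
    -- part moves `Di i` to a divisor meeting all conditions of uniqueness there, hence to `Di i`
    -- itself.
    have hle : G₁.ord (χ ∘ W.left.map) (G₁.vert b₁) < 0 ∨
        ∀ y, G₁.ord (χ ∘ W.left.map) y = 0 := by
      rw [or_iff_not_imp_left, not_lt]
      intro h0
      obtain ⟨A, B, -, hA0, hA, -⟩ := W.exists_push_add F
      set A' : G₁.Divisor := A + Finsupp.single (G₁.vert b₁)
        (c i + G₁.ord (χ ∘ W.left.map) (G₁.vert b₁)) with hA'
      have e1 : ∀ y, y ≠ G₁.vert b₁ → A' y = F (W.left.map y) := fun y hy => by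
        rw [hA', Finsupp.add_apply, hA y hy, Finsupp.single_eq_of_ne hy, add_zero]
      have e2 : A' (G₁.vert b₁) = c i + G₁.ord (χ ∘ W.left.map) (G₁.vert b₁) := by
        rw [hA', Finsupp.add_apply, hA0, Finsupp.single_eq_same, zero_add]
      have e3 : G₁.Moves (χ ∘ W.left.map) (Di i) A' := by
        refine ⟨hl, fun y => ?_⟩
        by_cases hy : y = G₁.vert b₁
        · subst hy
          rw [e2, h.verts]
          simp [Finsupp.single_eq_of_ne hxv.symm]
        · rw [e1 y hy, hχ.2, hvl i y hy, W.ord_left _ hy]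
      have e4 := h.unique i A' (LinEquiv.trans ⟨_, h.moves i⟩ ⟨_, e3⟩)
        (fun y hy => by rw [e1 y hy]; exact hF _ (htl y)) (by rw [e1 _ hxv]; exact hFx)
        (by rw [e2]; omega)
      intro y
      have := e3.2 y
      rw [e4] at this
      omega
    have hle0 : G₁.ord (χ ∘ W.left.map) (G₁.vert b₁) ≤ 0 := by
      rcases hle with h0 | h0
      · exact h0.le
      · exact (h0 _).le
    have hbv := hχ.2 (W.left.map (G₁.vert b₁))
    rw [W.ord_base, W.map_base, hvr, hQv, Finsupp.single_eq_of_ne htv.symm] at hbv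
    have hbF : 0 ≤ F (W.right.map (G₂.vert b₂)) :=
      hF _ (by rw [← W.map_base]; exact htl _)
    -- At the common vertex `F` is nonnegative while the left part contributes at most 0, so the
    -- right order is nonnegative; at `t` the bound `c' i ≤ F t` gives the same. Rigidity of `Q i`
    -- then applies.
    have hord := hrigid i _ hr fun y => by
      by_cases hy : y = G₂.vert b₂
      · subst hy; rw [hQv]; omega
      · have h1 := hχ.2 (W.right.map y)
        rw [W.ord_right _ hy, hvr] at h1
        by_cases hyt : y = G₂.vert t
        · subst hyt
          rw [Finsupp.single_eq_same] at h1
          omega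
        · rw [Finsupp.single_eq_of_ne hyt] at h1
          have h2 := hF (W.right.map y) fun e => hyt (W.right.map_inj e)
          omega
    -- With the right order zero, nonnegativity of `F` at the common vertex excludes a negative left
    -- order.
    rw [hord] at hbv
    have hord' : ∀ y, G₁.ord (χ ∘ W.left.map) y = 0 := by
      rcases hle with h0 | h0
      · omega
      · exact h0
    ext z
    rw [hχ.2 z]
    rcases W.cover z with ⟨y, rfl⟩ | ⟨y, rfl⟩
    · by_cases hy : y = G₁.vert b₁
      · subst hy
        rw [W.ord_base, hord, hord']; simp
      · rw [W.ord_left _ hy, hord', add_zero]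
    · by_cases hy : y = G₂.vert b₂
      · subst hy
        rw [← W.map_base, W.ord_base, hord, hord']; simp
      · rw [W.ord_right _ hy, hord, add_zero]
  · intro k F hF hdeg
    -- Chips of `F` at the common vertex go to `B`, so the rank condition on the left is used with
    -- the degree of `A` only.
    obtain ⟨A, B, hAB, hA0, hA, hB⟩ := W.exists_push_add F
    have hApos : 0 ≤ A := fun y => by
      by_cases hy : y = G₁.vert b₁
      · subst hy; exact hA0.ge
      · rw [hA y hy]; exact hF _
    have hBpos : 0 ≤ B := fun y => by rw [hB]; exact hF _
    have hdA : 0 ≤ degree A := Finset.sum_nonneg fun y _ => hApos y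
    have hdB : 0 ≤ degree B := Finset.sum_nonneg fun y _ => hBpos y
    rw [hAB, degree_add, Sub.degree_push, Sub.degree_push] at hdeg
    obtain ⟨a, ha⟩ := Int.eq_ofNat_of_zero_le hdA
    have hak : a ≤ k := by omega
    obtain ⟨F₁, hF₁, hF₁A, hF₁b⟩ := h.rank ⟨a, by omega⟩ A hApos (by simpa using ha)
    set j : Fin (r + 1) := ⟨a, by omega⟩ with hj
    obtain ⟨R, hR0, hR⟩ : ∃ R : G₂.Divisor, 0 ≤ R ∧
        G₂.LinEquiv (Finsupp.single (G₂.vert b₂) (c j) + Finsupp.single p 1)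
          (B + Finsupp.single (G₂.vert t) (c' k) + R) := by
      -- If `A` has the full degree, then `B = 0` and the known section of the right part serves.
      -- Otherwise `hc` makes the degree c_j + 1 - (k - a) - c'_k of what is left at least 1.
      rcases hak.eq_or_lt with hak' | hak'
      · have hjk : j = k := Fin.ext hak'
        have hB0 : B = 0 := by
          have hs : ∑ y ∈ B.support, B y = 0 := show degree B = 0 by omega
          rw [Finset.sum_eq_zero_iff_of_nonneg fun y _ => hBpos y] at hs
          ext y
          by_contra hy
          exact hy (hs y (Finsupp.mem_support_iff.2 hy))
        refine ⟨Q k, hQ k, ?_⟩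
        rw [hB0, hjk, zero_add, add_comm (Finsupp.single (G₂.vert t) (c' k))]
        exact hQp k
      · have h1 := hc j k hak'
        obtain ⟨R, hR0, hR⟩ := heff (Finsupp.single (G₂.vert b₂) (c j) + Finsupp.single p 1 -
          (B + Finsupp.single (G₂.vert t) (c' k))) (by
            rw [degree_sub, degree_add, degree_add, degree_single, degree_single, degree_single]
            simp only [hj] at h1 ⊢
            omega)
        refine ⟨R, hR0, ?_⟩
        simpa [add_comm] using hR.add_right (B + Finsupp.single (G₂.vert t) (c' k))
    refine ⟨W.left.push (F₁ + Finsupp.single (G₁.vert b₁) (-c j)) +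
      W.right.push (B + Finsupp.single (G₂.vert t) (c' k) + R), ?_, ?_, ?_⟩
    · rw [hpush D (c j)]
      exact W.linEquiv (hF₁.add_right _) hR
    · have hright : ∀ y, y ≠ G₂.vert t → 0 ≤ W.left.push (F₁ + Finsupp.single (G₁.vert b₁) (-c j))
          (W.right.map y) → F (W.right.map y) ≤
          (W.left.push (F₁ + Finsupp.single (G₁.vert b₁) (-c j)) +
            W.right.push (B + Finsupp.single (G₂.vert t) (c' k) + R)) (W.right.map y) := by
        intro y hy h0
        rw [Finsupp.add_apply, Sub.push_map, Finsupp.add_apply, Finsupp.add_apply,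
          Finsupp.single_eq_of_ne hy, ← hB]
        have := hR0 y
        simp only [Finsupp.coe_zero, Pi.zero_apply] at this
        omega
      have hb0 : 0 ≤ W.left.push (F₁ + Finsupp.single (G₁.vert b₁) (-c j))
          (W.right.map (G₂.vert b₂)) := by
        rw [W.push_left_base, Finsupp.add_apply, Finsupp.single_eq_same]
        omega
      intro z hz
      rw [htip] at hz
      rcases W.cover z with ⟨y, rfl⟩ | ⟨y, rfl⟩
      · by_cases hy : y = G₁.vert b₁
        · subst hy
          rw [W.map_base]
          exact hright _ htv.symm hb0
        · rw [Finsupp.add_apply, Sub.push_map, W.push_right_left _ hy, Finsupp.add_apply,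
            Finsupp.single_eq_of_ne hy, add_zero, add_zero, ← hA y hy]
          exact hF₁A y hy
      · refine hright y (fun e => hz (by rw [e])) ?_
        by_cases hy : y = G₂.vert b₂
        · rw [hy]; exact hb0
        · rw [W.push_left_right _ hy]
    · rw [htip, Finsupp.add_apply, W.push_left_right _ htv, Sub.push_map, Finsupp.add_apply,
        Finsupp.add_apply, Finsupp.single_eq_same]
      have h1 := hBpos (G₂.vert t)
      have h2 := hR0 (G₂.vert t)
      simp only [Finsupp.coe_zero, Pi.zero_apply] at h1 h2
      omega

end Wedge
end MetricGraph

/-! ### Piecewise linear functions on a loop -/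

/-- The break at `s` itself counts as already risen to the right and still flat to the left; hence
the non-strict inequality here and the strict one for left slopes. -/
theorem hasRightSlope_max (s u : ℝ) :
    HasRightSlope (fun u => max (u - s) 0) u (if s ≤ u then 1 else 0) := by
  split_ifs with h
  · filter_upwards [self_mem_nhdsWithin] with v hv
    have hv : u < v := hv
    rw [max_eq_left (by linarith), max_eq_left (by linarith)]
    push_cast; ring
  · filter_upwards [Ioo_mem_nhdsGT (not_le.1 h)] with v hv
    rw [max_eq_right (by linarith [hv.2]), max_eq_right (by linarith)]
    simp

theorem hasLeftSlope_max (s u : ℝ) :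
    HasLeftSlope (fun u => max (u - s) 0) u (-if s < u then 1 else 0) := by
  split_ifs with h
  · filter_upwards [Ioo_mem_nhdsLT h] with v hv
    rw [max_eq_left (by linarith [hv.1]), max_eq_left (by linarith)]
    push_cast; ring
  · filter_upwards [self_mem_nhdsWithin] with v hv
    have hv : v < u := hv
    rw [max_eq_right (by linarith), max_eq_right (by linarith)]
    simp

theorem HasRightSlope.sum {ι : Type} (S : Finset ι) (a k : ι → ℤ) (φ : ι → ℝ → ℝ) (t : ℝ)
    (h : ∀ i, HasRightSlope (φ i) t (k i)) :
    HasRightSlope (fun u => ∑ i ∈ S, a i * φ i u) t (∑ i ∈ S, a i * k i) := by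
  classical
  induction S using Finset.induction_on with
  | empty => simpa using hasRightSlope_const 0 t
  | insert i S hi ih =>
    simp only [Finset.sum_insert hi]
    exact ((h i).int_mul (a i)).add ih

theorem HasLeftSlope.sum {ι : Type} (S : Finset ι) (a k : ι → ℤ) (φ : ι → ℝ → ℝ) (t : ℝ)
    (h : ∀ i, HasLeftSlope (φ i) t (k i)) :
    HasLeftSlope (fun u => ∑ i ∈ S, a i * φ i u) t (∑ i ∈ S, a i * k i) := by
  classical
  induction S using Finset.induction_on with
  | empty => simpa using hasLeftSlope_const 0 t
  | insert i S hi ih =>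
    simp only [Finset.sum_insert hi]
    exact ((h i).int_mul (a i)).add ih

theorem hasRightSlope_min (t u : ℝ) :
    HasRightSlope (fun u => min u t) u (if u < t then 1 else 0) := by
  split_ifs with h
  · filter_upwards [Ioo_mem_nhdsGT h] with v hv
    rw [min_eq_left hv.2.le, min_eq_left h.le]
    push_cast; ring
  · filter_upwards [self_mem_nhdsWithin] with v hv
    have hv : u < v := hv
    rw [min_eq_right (by linarith), min_eq_right (by linarith)]
    simp

theorem hasLeftSlope_min (t u : ℝ) :
    HasLeftSlope (fun u => min u t) u (-if u ≤ t then 1 else 0) := by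
  split_ifs with h
  · filter_upwards [self_mem_nhdsWithin] with v hv
    have hv : v < u := hv
    rw [min_eq_left (by linarith), min_eq_left h]
    push_cast; ring
  · filter_upwards [Ioo_mem_nhdsLT (not_le.1 h)] with v hv
    rw [min_eq_right hv.1.le, min_eq_right (by linarith)]
    simp

/-! ### One loop with a bridge -/

namespace ChainLengths

open MetricGraph

/-- The loop number `k` together with the bridge to its right. The vertices are `v_k`, `w_k`,
`v_{k+1}`, and the edges are the top and the bottom edge and the bridge. -/
def lollipop (L : ChainLengths) (k : ℕ) : MetricGraph (Fin 3) (Fin 3) where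
  src | 0 => 0 | 1 => 0 | 2 => 1
  tgt | 0 => 1 | 1 => 1 | 2 => 2
  len | 0 => L.top k | 1 => L.bottom k | 2 => L.bridge k
  len_pos | 0 => L.top_pos k | 1 => L.bottom_pos k | 2 => L.bridge_pos k

/-- The length of a loop. -/
noncomputable def girth (L : ChainLengths) (k : ℕ) : ℝ := L.top k + L.bottom k

variable (L : ChainLengths) (k : ℕ)

/-- The function on the lollipop which is `F` on the loop, where the bottom edge is parametrized by
`[0, bottom k]` and the top edge, backwards, by `[bottom k, girth k]`, and `T` on the bridge. -/
noncomputable def lollipopFun (F T : ℝ → ℝ) : (L.lollipop k).Point → ℝ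
  | Sum.inl 0 => F 0
  | Sum.inl 1 => F (L.bottom k)
  | Sum.inl 2 => T (L.bridge k)
  | Sum.inr ⟨0, t⟩ => F (L.girth k - t)
  | Sum.inr ⟨1, t⟩ => F t
  | Sum.inr ⟨2, t⟩ => T t

/-- The points of the loop. -/
noncomputable def loopPt (s : ℝ) : (L.lollipop k).Point :=
  if s ≤ L.bottom k then (L.lollipop k).pt 1 s else (L.lollipop k).pt 0 (L.girth k - s)

variable {L k} {F T : ℝ → ℝ}

theorem lollipopFun_top (h0 : F 0 = F (L.girth k)) {u : ℝ} (h1 : 0 ≤ u) (h2 : u ≤ L.top k) :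
    L.lollipopFun k F T ((L.lollipop k).pt 0 u) = F (L.girth k - u) := by
  rcases h1.eq_or_lt with rfl | h1
  · rw [pt_zero, sub_zero, ← h0]; rfl
  rcases h2.eq_or_lt with rfl | h2
  · rw [show L.girth k - L.top k = L.bottom k by rw [girth]; ring]
    exact congrArg _ (pt_len (G := L.lollipop k) 0)
  · rw [pt_of_mem 0 (show u ∈ Set.Ioo 0 ((L.lollipop k).len 0) from ⟨h1, h2⟩)]; rfl

theorem lollipopFun_bottom {u : ℝ} (h1 : 0 ≤ u) (h2 : u ≤ L.bottom k) :
    L.lollipopFun k F T ((L.lollipop k).pt 1 u) = F u := by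
  rcases h1.eq_or_lt with rfl | h1
  · rw [pt_zero]; rfl
  rcases h2.eq_or_lt with rfl | h2
  · exact congrArg _ (pt_len (G := L.lollipop k) 1)
  · rw [pt_of_mem 1 (show u ∈ Set.Ioo 0 ((L.lollipop k).len 1) from ⟨h1, h2⟩)]; rfl

theorem lollipopFun_bridge (h0 : F (L.bottom k) = T 0) {u : ℝ} (h1 : 0 ≤ u)
    (h2 : u ≤ L.bridge k) : L.lollipopFun k F T ((L.lollipop k).pt 2 u) = T u := by
  rcases h1.eq_or_lt with rfl | h1
  · rw [pt_zero, ← h0]; rfl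
  rcases h2.eq_or_lt with rfl | h2
  · exact congrArg _ (pt_len (G := L.lollipop k) 2)
  · rw [pt_of_mem 2 (show u ∈ Set.Ioo 0 ((L.lollipop k).len 2) from ⟨h1, h2⟩)]; rfl

theorem bottom_lt_girth : L.bottom k < L.girth k := by
  have := L.top_pos k
  rw [girth]; linarith

theorem girth_pos : 0 < L.girth k := (L.bottom_pos k).trans bottom_lt_girth

/-- The top edge is run through against the parameter of the loop, so the two directions are
exchanged. -/
theorem rightSlope_top (hF : PLOn F 0 (L.girth k)) (h0 : F 0 = F (L.girth k)) {t : ℝ}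
    (h1 : 0 ≤ t) (h2 : t < L.top k) :
    HasRightSlope (fun u => L.lollipopFun k F T ((L.lollipop k).pt 0 u)) t
      (leftSlope F (L.girth k - t)) := by
  have := L.bottom_pos k
  refine HasRightSlope.congr (hF.left (t := L.girth k - t) ?_ ?_).comp_const_sub h2
    fun u h3 h4 => lollipopFun_top h0 (h1.trans h3) h4.le <;> rw [girth] <;> linarith

theorem leftSlope_top (hF : PLOn F 0 (L.girth k)) (h0 : F 0 = F (L.girth k)) {t : ℝ}
    (h1 : 0 < t) (h2 : t ≤ L.top k) :
    HasLeftSlope (fun u => L.lollipopFun k F T ((L.lollipop k).pt 0 u)) t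
      (rightSlope F (L.girth k - t)) := by
  have := L.bottom_pos k
  refine HasLeftSlope.congr (hF.right (t := L.girth k - t) ?_ ?_).comp_const_sub h1
    fun u h3 h4 => lollipopFun_top h0 h3.le (h4.trans h2) <;> rw [girth] <;> linarith

theorem rightSlope_bottom (hF : PLOn F 0 (L.girth k)) {t : ℝ} (h1 : 0 ≤ t)
    (h2 : t < L.bottom k) :
    HasRightSlope (fun u => L.lollipopFun k F T ((L.lollipop k).pt 1 u)) t (rightSlope F t) :=
  HasRightSlope.congr (hF.right h1 (h2.trans bottom_lt_girth)) h2
    fun _ h3 h4 => lollipopFun_bottom (h1.trans h3) h4.le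

theorem leftSlope_bottom (hF : PLOn F 0 (L.girth k)) {t : ℝ} (h1 : 0 < t)
    (h2 : t ≤ L.bottom k) :
    HasLeftSlope (fun u => L.lollipopFun k F T ((L.lollipop k).pt 1 u)) t (leftSlope F t) :=
  HasLeftSlope.congr (hF.left h1 (h2.trans bottom_lt_girth.le)) h1
    fun _ h3 h4 => lollipopFun_bottom h3.le (h4.trans h2)

theorem rightSlope_bridge (hT : PLOn T 0 (L.bridge k)) (hw : F (L.bottom k) = T 0) {t : ℝ}
    (h1 : 0 ≤ t) (h2 : t < L.bridge k) :
    HasRightSlope (fun u => L.lollipopFun k F T ((L.lollipop k).pt 2 u)) t (rightSlope T t) :=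
  HasRightSlope.congr (hT.right h1 h2) h2
    fun _ h3 h4 => lollipopFun_bridge hw (h1.trans h3) h4.le

theorem leftSlope_bridge (hT : PLOn T 0 (L.bridge k)) (hw : F (L.bottom k) = T 0) {t : ℝ}
    (h1 : 0 < t) (h2 : t ≤ L.bridge k) :
    HasLeftSlope (fun u => L.lollipopFun k F T ((L.lollipop k).pt 2 u)) t (leftSlope T t) :=
  HasLeftSlope.congr (hT.left h1 h2) h1
    fun _ h3 h4 => lollipopFun_bridge hw h3.le (h4.trans h2)

theorem isPL_lollipopFun (hF : PLOn F 0 (L.girth k)) (hT : PLOn T 0 (L.bridge k))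
    (h0 : F 0 = F (L.girth k)) (hw : F (L.bottom k) = T 0) :
    (L.lollipop k).IsPL (L.lollipopFun k F T) := by
  intro e t
  match e with
  | 0 => exact ⟨fun h1 h2 => ⟨_, rightSlope_top hF h0 h1 h2⟩,
      fun h1 h2 => ⟨_, leftSlope_top hF h0 h1 h2⟩⟩
  | 1 => exact ⟨fun h1 h2 => ⟨_, rightSlope_bottom hF h1 h2⟩,
      fun h1 h2 => ⟨_, leftSlope_bottom hF h1 h2⟩⟩
  | 2 => exact ⟨fun h1 h2 => ⟨_, rightSlope_bridge hT hw h1 h2⟩,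
      fun h1 h2 => ⟨_, leftSlope_bridge hT hw h1 h2⟩⟩

/-- The coefficients of a principal divisor on the lollipop at the vertices. -/
theorem ord_lollipop (f : (L.lollipop k).Point → ℝ) :
    (L.lollipop k).ord f (Sum.inl 0) =
      -(rightSlope (fun u => f ((L.lollipop k).pt 0 u)) 0 +
        rightSlope (fun u => f ((L.lollipop k).pt 1 u)) 0) ∧
    (L.lollipop k).ord f (Sum.inl 1) =
      -(rightSlope (fun u => f ((L.lollipop k).pt 2 u)) 0 +
        (leftSlope (fun u => f ((L.lollipop k).pt 0 u)) (L.top k) +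
        leftSlope (fun u => f ((L.lollipop k).pt 1 u)) (L.bottom k))) ∧
    (L.lollipop k).ord f (Sum.inl 2) =
      -leftSlope (fun u => f ((L.lollipop k).pt 2 u)) (L.bridge k) := by
  refine ⟨?_, ?_, ?_⟩ <;> simp [ord, Fin.sum_univ_three, lollipop]

theorem ord_lollipopFun (hF : PLOn F 0 (L.girth k)) (hT : PLOn T 0 (L.bridge k))
    (h0 : F 0 = F (L.girth k)) (hw : F (L.bottom k) = T 0) :
    (L.lollipop k).ord (L.lollipopFun k F T) (Sum.inl 0) =
      -(rightSlope F 0 + leftSlope F (L.girth k)) ∧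
    (L.lollipop k).ord (L.lollipopFun k F T) (Sum.inl 1) =
      -(rightSlope F (L.bottom k) + leftSlope F (L.bottom k) + rightSlope T 0) ∧
    (L.lollipop k).ord (L.lollipopFun k F T) (Sum.inl 2) = -leftSlope T (L.bridge k) ∧
    (∀ t, (L.lollipop k).ord (L.lollipopFun k F T) (Sum.inr ⟨0, t⟩) =
      -(rightSlope F (L.girth k - t) + leftSlope F (L.girth k - t))) ∧
    (∀ t, (L.lollipop k).ord (L.lollipopFun k F T) (Sum.inr ⟨1, t⟩) =
      -(rightSlope F t + leftSlope F t)) ∧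
    (∀ t, (L.lollipop k).ord (L.lollipopFun k F T) (Sum.inr ⟨2, t⟩) =
      -(rightSlope T t + leftSlope T t)) := by
  have e : L.girth k - L.top k = L.bottom k := by rw [girth]; ring
  obtain ⟨i1, i2, i3⟩ := ord_lollipop (L.lollipopFun k F T)
  refine ⟨?_, ?_, ?_, ?_, ?_, ?_⟩
  · rw [i1, (rightSlope_top hF h0 le_rfl (L.top_pos k)).rightSlope_eq,
      (rightSlope_bottom hF le_rfl (L.bottom_pos k)).rightSlope_eq, sub_zero, add_comm]
  · rw [i2, (leftSlope_top hF h0 (L.top_pos k) le_rfl).leftSlope_eq,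
      (leftSlope_bottom hF (L.bottom_pos k) le_rfl).leftSlope_eq,
      (rightSlope_bridge hT hw le_rfl (L.bridge_pos k)).rightSlope_eq, e, add_comm]
  · rw [i3, (leftSlope_bridge hT hw (L.bridge_pos k) le_rfl).leftSlope_eq]
  · rintro ⟨t, h1, h2⟩
    simp only [ord, (rightSlope_top hF h0 h1.le h2).rightSlope_eq,
      (leftSlope_top hF h0 h1 (le_of_lt h2)).leftSlope_eq]
    ring
  · rintro ⟨t, h1, h2⟩
    simp only [ord, (rightSlope_bottom hF h1.le h2).rightSlope_eq,
      (leftSlope_bottom hF h1 (le_of_lt h2)).leftSlope_eq]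
  · rintro ⟨t, h1, h2⟩
    simp only [ord, (rightSlope_bridge hT hw h1.le h2).rightSlope_eq,
      (leftSlope_bridge hT hw h1 (le_of_lt h2)).leftSlope_eq]

theorem plOn_const (a b c : ℝ) : PLOn (fun _ => a) b c :=
  fun _ => ⟨fun _ _ => ⟨0, hasRightSlope_const _ _⟩, fun _ _ => ⟨0, hasLeftSlope_const _ _⟩⟩

theorem loopPt_zero : L.loopPt k 0 = (L.lollipop k).vert 0 := by
  rw [loopPt, if_pos (L.bottom_pos k).le, pt_zero]; rfl

theorem loopPt_girth : L.loopPt k (L.girth k) = (L.lollipop k).vert 0 := by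
  rw [loopPt, if_neg bottom_lt_girth.not_ge, sub_self, pt_zero]; rfl

theorem loopPt_bottom : L.loopPt k (L.bottom k) = (L.lollipop k).vert 1 := by
  rw [loopPt, if_pos le_rfl]
  exact pt_len (G := L.lollipop k) 1

theorem loopPt_of_lt_bottom {s : ℝ} (h1 : 0 < s) (h2 : s < L.bottom k) :
    L.loopPt k s = Sum.inr ⟨1, ⟨s, h1, h2⟩⟩ := by
  rw [loopPt, if_pos h2.le, pt_of_mem 1 (show s ∈ Set.Ioo 0 ((L.lollipop k).len 1) from ⟨h1, h2⟩)]

theorem girth_sub_mem {s : ℝ} (h1 : L.bottom k < s) (h2 : s < L.girth k) :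
    L.girth k - s ∈ Set.Ioo 0 ((L.lollipop k).len 0) :=
  ⟨sub_pos.2 h2, show L.girth k - s < L.top k by rw [girth]; linarith⟩

theorem loopPt_of_bottom_lt {s : ℝ} (h1 : L.bottom k < s) (h2 : s < L.girth k) :
    L.loopPt k s = Sum.inr ⟨0, ⟨L.girth k - s, girth_sub_mem h1 h2⟩⟩ := by
  rw [loopPt, if_neg h1.not_ge, pt_of_mem]

/-- Where a point of the loop can be. -/
theorem loopPt_cases {s : ℝ} (hs : s ∈ Set.Icc 0 (L.girth k)) :
    ((s = 0 ∨ s = L.girth k) ∧ L.loopPt k s = Sum.inl 0) ∨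
    (s = L.bottom k ∧ L.loopPt k s = Sum.inl 1) ∨
    (∃ h : s ∈ Set.Ioo 0 ((L.lollipop k).len 1), L.loopPt k s = Sum.inr ⟨1, ⟨s, h⟩⟩) ∨
    ∃ h : L.girth k - s ∈ Set.Ioo 0 ((L.lollipop k).len 0),
      L.loopPt k s = Sum.inr ⟨0, ⟨L.girth k - s, h⟩⟩ := by
  rcases hs.1.eq_or_lt with rfl | h1
  · exact Or.inl ⟨Or.inl rfl, loopPt_zero⟩
  rcases hs.2.eq_or_lt with rfl | h2
  · exact Or.inl ⟨Or.inr rfl, loopPt_girth⟩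
  rcases lt_trichotomy s (L.bottom k) with h | rfl | h
  · exact Or.inr (Or.inr (Or.inl ⟨⟨h1, h⟩, loopPt_of_lt_bottom h1 h⟩))
  · exact Or.inr (Or.inl ⟨rfl, loopPt_bottom⟩)
  · exact Or.inr (Or.inr (Or.inr ⟨girth_sub_mem h h2, loopPt_of_bottom_lt h h2⟩))

/-- Abel's theorem for a loop: a divisor of degree `0` is principal if the positions of its points,
counted with multiplicities, add up to `0`. -/
theorem linEquiv_zero_of_moment_eq_zero (n : ℝ →₀ ℤ)
    (hn : ∀ s ∈ n.support, s ∈ Set.Icc 0 (L.girth k)) (hdeg : (n.sum fun _ a => a) = 0)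
    (hmom : (n.sum fun s a => (a : ℝ) * s) = 0) :
    (L.lollipop k).LinEquiv (n.mapDomain (L.loopPt k)) 0 := by
  classical
  -- A sum of hinges: the slope changes by `n s` at `s`, and degree zero makes `F` flat beyond the
  -- last point.
  set F : ℝ → ℝ := fun u => ∑ s ∈ n.support, n s * max (u - s) 0 with hFdef
  have hR : ∀ u, HasRightSlope F u (∑ s ∈ n.support, n s * if s ≤ u then 1 else 0) := fun u =>
    HasRightSlope.sum n.support n (fun s => if s ≤ u then 1 else 0)
      (fun s u => max (u - s) 0) u fun s => hasRightSlope_max s u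
  have hL : ∀ u, HasLeftSlope F u (∑ s ∈ n.support, n s * -if s < u then 1 else 0) := fun u =>
    HasLeftSlope.sum n.support n (fun s => -if s < u then 1 else 0)
      (fun s u => max (u - s) 0) u fun s => hasLeftSlope_max s u
  have hF : PLOn F 0 (L.girth k) := fun t => ⟨fun _ _ => ⟨_, hR t⟩, fun _ _ => ⟨_, hL t⟩⟩
  have hRL : ∀ u, rightSlope F u + leftSlope F u = n u := by
    intro u
    rw [(hR u).rightSlope_eq, (hL u).leftSlope_eq, ← Finset.sum_add_distrib]
    have : ∀ s ∈ n.support, (n s * if s ≤ u then 1 else 0) + (n s * -if s < u then 1 else 0) =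
        if s = u then n s else 0 := by
      intro s _
      rcases lt_trichotomy s u with h | rfl | h
      · simp [h, h.le, h.ne]
      · simp
      · simp [h.not_ge, h.not_gt, h.ne']
    rw [Finset.sum_congr rfl this, Finset.sum_ite_eq']
    split_ifs with h
    · rfl
    · exact (Finsupp.notMem_support_iff.1 h).symm
  have hR0 : rightSlope F 0 = n 0 := by
    have h : leftSlope F 0 = 0 := by
      rw [(hL 0).leftSlope_eq]
      refine Finset.sum_eq_zero fun s hs => ?_
      rw [if_neg (hn s hs).1.not_gt, neg_zero, mul_zero]
    have := hRL 0
    omega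
  have hLT : leftSlope F (L.girth k) = n (L.girth k) := by
    have h : rightSlope F (L.girth k) = 0 := by
      rw [(hR _).rightSlope_eq, ← hdeg]
      refine Finset.sum_congr rfl fun s hs => ?_
      rw [if_pos (hn s hs).2, mul_one]
    have := hRL (L.girth k)
    omega
  -- At the far end every hinge is linear, so the value is the girth times the degree minus the
  -- moment. Both vanish, so `F` closes up on the loop.
  have h0 : F 0 = F (L.girth k) := by
    have e1 : F 0 = 0 := Finset.sum_eq_zero fun s hs => by
      rw [max_eq_right (by linarith [(hn s hs).1]), mul_zero]
    have e2 : F (L.girth k) = ∑ s ∈ n.support, (n s * L.girth k - n s * s) :=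
      Finset.sum_congr rfl fun s hs => by
        rw [max_eq_left (by linarith [(hn s hs).2])]; ring
    have hdeg' : ∑ s ∈ n.support, (n s : ℝ) = 0 := by exact_mod_cast hdeg
    have hmom' : ∑ s ∈ n.support, (n s : ℝ) * s = 0 := hmom
    rw [e1, e2, Finset.sum_sub_distrib, ← Finset.sum_mul, hdeg', hmom']
    ring
  have hT := plOn_const (F (L.bottom k)) 0 (L.bridge k)
  have hTR : ∀ t, rightSlope (fun _ : ℝ => F (L.bottom k)) t = 0 := fun t =>
    (hasRightSlope_const _ t).rightSlope_eq
  have hTL : ∀ t, leftSlope (fun _ : ℝ => F (L.bottom k)) t = 0 := fun t =>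
    (hasLeftSlope_const _ t).leftSlope_eq
  obtain ⟨o0, o1, o2, p0, p1, p2⟩ := ord_lollipopFun hF hT h0 rfl
  have hmap : ∀ x, n.mapDomain (L.loopPt k) x =
      ∑ s ∈ n.support, if L.loopPt k s = x then n s else 0 := by
    intro x
    rw [Finsupp.mapDomain, Finsupp.sum_apply, Finsupp.sum]
    exact Finset.sum_congr rfl fun s _ => Finsupp.single_apply
  have hone : ∀ x t, (∀ s ∈ n.support, L.loopPt k s = x ↔ s = t) →
      n.mapDomain (L.loopPt k) x = n t := by
    intro x t h
    rw [hmap, Finset.sum_congr rfl fun s hs => if_congr (h s hs) rfl rfl, Finset.sum_ite_eq']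
    split_ifs with h
    · rfl
    · exact (Finsupp.notMem_support_iff.1 h).symm
  have hg := girth_pos (L := L) (k := k)
  have hb := bottom_lt_girth (L := L) (k := k)
  have hb0 := L.bottom_pos k
  refine ⟨L.lollipopFun k F fun _ => F (L.bottom k), isPL_lollipopFun hF hT h0 rfl, ?_⟩
  rintro (z | ⟨e, t, ht⟩)
  · match z with
    | 0 =>
      have : n.mapDomain (L.loopPt k) (Sum.inl 0) = n 0 + n (L.girth k) := by
        rw [hmap]
        have : ∀ s ∈ n.support, (if L.loopPt k s = Sum.inl 0 then n s else 0) =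
            (if s = 0 then n s else 0) + if s = L.girth k then n s else 0 := by
          intro s hs
          rcases loopPt_cases (hn s hs) with ⟨rfl | rfl, h⟩ | ⟨rfl, h⟩ | ⟨h1, h⟩ | ⟨h1, h⟩
          · simp [h, hg.ne]
          · simp [h, hg.ne']
          · simp [h, hb.ne, hb0.ne']
          · have : s < L.girth k := lt_trans h1.2 hb
            simp [h, h1.1.ne', this.ne]
          · have h3 : L.girth k - s < L.top k := h1.2
            have h4 : s ≠ 0 := by rintro rfl; rw [girth] at h3; linarith
            have h5 : s ≠ L.girth k := by rintro rfl; simpa using h1.1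
            simp [h, h4, h5]
        rw [Finset.sum_congr rfl this, Finset.sum_add_distrib, Finset.sum_ite_eq',
          Finset.sum_ite_eq']
        congr 1 <;> split_ifs with h <;>
          first | rfl | exact (Finsupp.notMem_support_iff.1 h).symm
      rw [o0, this, hR0, hLT]; simp
    | 1 =>
      rw [o1, hone _ (L.bottom k), hRL, hTR]
      · simp
      intro s hs
      rcases loopPt_cases (hn s hs) with ⟨rfl | rfl, h⟩ | ⟨rfl, h⟩ | ⟨h1, h⟩ | ⟨h1, h⟩
      · simp [h, hb0.ne]
      · simp [h, hb.ne']
      · simp [h]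
      · have h2 : s < L.bottom k := h1.2
        simp [h, h2.ne]
      · have h3 : L.girth k - s < L.top k := h1.2
        have h4 : s ≠ L.bottom k := by rintro rfl; rw [girth] at h3; linarith
        simp [h, h4]
    | 2 =>
      rw [o2, hTL, hmap, Finset.sum_eq_zero]
      · simp
      intro s hs
      rcases loopPt_cases (hn s hs) with ⟨rfl | rfl, h⟩ | ⟨rfl, h⟩ | ⟨h1, h⟩ | ⟨h1, h⟩ <;> simp [h]
  · match e, ht with
    | 0, ht =>
      rw [p0, hRL, hone _ (L.girth k - t)]
      · simp
      have ht2 : t < L.top k := ht.2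
      intro s hs
      rcases loopPt_cases (hn s hs) with ⟨rfl | rfl, h⟩ | ⟨rfl, h⟩ | ⟨h1, h⟩ | ⟨h1, h⟩
      · rw [h]; simp; rw [girth]; linarith
      · rw [h]; simp; linarith [ht.1]
      · rw [h]; simp; rw [girth]; linarith
      · have h2 : s < L.bottom k := h1.2
        rw [h]; simp; rw [girth]; linarith
      · rw [h]; simp; exact ⟨fun _ => by linarith, fun _ => by linarith⟩
    | 1, ht =>
      rw [p1, hRL, hone _ t]
      · simp
      have ht2 : t < L.bottom k := ht.2
      intro s hs
      rcases loopPt_cases (hn s hs) with ⟨rfl | rfl, h⟩ | ⟨rfl, h⟩ | ⟨h1, h⟩ | ⟨h1, h⟩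
      · rw [h]; simp; linarith [ht.1]
      · rw [h]; simp; linarith
      · rw [h]; simp; linarith
      · rw [h]; simp
      · have h3 : L.girth k - s < L.top k := h1.2
        rw [h]; simp; rw [girth] at h3; linarith
    | 2, ht =>
      rw [p2, hTR, hTL, hmap, Finset.sum_eq_zero]
      · simp
      intro s hs
      rcases loopPt_cases (hn s hs) with ⟨rfl | rfl, h⟩ | ⟨rfl, h⟩ | ⟨h1, h⟩ | ⟨h1, h⟩ <;> simp [h]

end ChainLengths

theorem MetricGraph.inr_ne_inr {V E : Type} {G : MetricGraph V E} {e : E} {u t : ℝ}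
    (hu : u ∈ Set.Ioo 0 (G.len e)) (ht : t ∈ Set.Ioo 0 (G.len e)) (h : u ≠ t) :
    (Sum.inr ⟨e, ⟨u, hu⟩⟩ : G.Point) ≠ Sum.inr ⟨e, ⟨t, ht⟩⟩ := by
  simpa using h

namespace ChainLengths

open MetricGraph

variable {L : ChainLengths} {k : ℕ}

/-- The sum of the positions modulo the length of the loop decides. -/
theorem linEquiv_zero_of_moment_eq_mul_girth (n : ℝ →₀ ℤ)
    (hn : ∀ s ∈ n.support, s ∈ Set.Icc 0 (L.girth k)) (hdeg : (n.sum fun _ a => a) = 0) (j : ℤ)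
    (hmom : (n.sum fun s a => (a : ℝ) * s) = j * L.girth k) :
    (L.lollipop k).LinEquiv (n.mapDomain (L.loopPt k)) 0 := by
  classical
  have hg := girth_pos (L := L) (k := k)
  have hadd : ∀ (p q : ℝ →₀ ℤ), (p + q).sum (fun s a => (a : ℝ) * s) =
      p.sum (fun s a => (a : ℝ) * s) + q.sum (fun s a => (a : ℝ) * s) := fun p q =>
    Finsupp.sum_add_index' (by simp) (by intros; push_cast; ring)
  have hadd' : ∀ (p q : ℝ →₀ ℤ), (p + q).sum (fun _ a => a) =
      p.sum (fun _ a => a) + q.sum (fun _ a => a) := fun p q =>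
    Finsupp.sum_add_index' (fun _ => rfl) fun _ _ _ => rfl
  -- The parameters 0 and `girth` denote the same vertex: adding j and -j there does not change the
  -- divisor but corrects the moment by -j times the girth.
  have h := linEquiv_zero_of_moment_eq_zero (L := L) (k := k)
    (n + (Finsupp.single 0 j + Finsupp.single (L.girth k) (-j))) (fun s hs => ?_) ?_ ?_
  · rw [Finsupp.mapDomain_add, Finsupp.mapDomain_add, Finsupp.mapDomain_single,
      Finsupp.mapDomain_single, loopPt_zero, loopPt_girth, ← Finsupp.single_add,
      add_neg_cancel, Finsupp.single_zero, add_zero] at h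
    exact h
  · rcases Finset.mem_union.1 (Finsupp.support_add hs) with hs | hs
    · exact hn s hs
    rcases Finset.mem_union.1 (Finsupp.support_add hs) with hs | hs
    · rw [Finset.mem_singleton.1 (Finsupp.support_single_subset hs)]; exact ⟨le_rfl, hg.le⟩
    · rw [Finset.mem_singleton.1 (Finsupp.support_single_subset hs)]; exact ⟨hg.le, le_rfl⟩
  · rw [hadd', hadd', hdeg, Finsupp.sum_single_index rfl, Finsupp.sum_single_index rfl]
    ring
  · rw [hadd, hadd, hmom, Finsupp.sum_single_index (by simp), Finsupp.sum_single_index (by simp)]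
    push_cast; ring

/-- All points of the bridge are equivalent. -/
theorem linEquiv_bridge {t : ℝ} (h1 : 0 < t) (h2 : t ≤ L.bridge k) :
    (L.lollipop k).LinEquiv (Finsupp.single ((L.lollipop k).vert 1) 1)
      (Finsupp.single ((L.lollipop k).pt 2 t) 1) := by
  classical
  have hF := plOn_const 0 0 (L.girth k)
  have hT : PLOn (fun u => min u t) 0 (L.bridge k) := fun u =>
    ⟨fun _ _ => ⟨_, hasRightSlope_min t u⟩, fun _ _ => ⟨_, hasLeftSlope_min t u⟩⟩
  have hw : (0 : ℝ) = min 0 t := (min_eq_left h1.le).symm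
  have hFR : ∀ t, rightSlope (fun _ : ℝ => 0) t = 0 := fun t =>
    (hasRightSlope_const _ t).rightSlope_eq
  have hFL : ∀ t, leftSlope (fun _ : ℝ => 0) t = 0 := fun t =>
    (hasLeftSlope_const _ t).leftSlope_eq
  have hTR := fun u => (hasRightSlope_min t u).rightSlope_eq
  have hTL := fun u => (hasLeftSlope_min t u).leftSlope_eq
  refine ⟨_, isPL_lollipopFun hF hT rfl hw, ?_⟩
  obtain ⟨o0, o1, o2, p0, p1, p2⟩ := ord_lollipopFun hF hT rfl hw
  have hp : (h2' : t < L.bridge k) → (L.lollipop k).pt 2 t = Sum.inr ⟨2, ⟨t, h1, h2'⟩⟩ :=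
    fun h2' => pt_of_mem 2 (show t ∈ Set.Ioo 0 ((L.lollipop k).len 2) from ⟨h1, h2'⟩)
  have hp' : t = L.bridge k → (L.lollipop k).pt 2 t = Sum.inl 2 := by
    rintro rfl; exact pt_len (G := L.lollipop k) 2
  rintro (z | ⟨e, u, hu⟩)
  · match z with
    | 0 =>
      rw [o0, hFR, hFL]
      rcases h2.eq_or_lt with h | h
      · simp [hp' h]
      · simp [hp h]
    | 1 =>
      rw [o1, hFR, hFL, hTR, if_pos h1]
      rcases h2.eq_or_lt with h | h
      · simp [hp' h]
      · simp [hp h]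
    | 2 =>
      rw [o2, hTL]
      rcases h2.eq_or_lt with h | h
      · simp [hp' h, h.ge]
      · simp [hp h, h.not_ge]
  · match e, hu with
    | 0, hu =>
      rw [p0, hFR, hFL]
      rcases h2.eq_or_lt with h | h
      · simp [hp' h]
      · simp [hp h]
    | 1, hu =>
      rw [p1, hFR, hFL]
      rcases h2.eq_or_lt with h | h
      · simp [hp' h]
      · simp [hp h]
    | 2, hu =>
      rw [p2, hTR, hTL]
      rcases h2.eq_or_lt with h | h
      · have : u < t := by rw [h]; exact hu.2
        simp [hp' h, this, this.le]
      · rcases lt_trichotomy u t with h' | rfl | h'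
        · rw [hp h, Finsupp.single_eq_of_ne (inr_ne_inr hu ⟨h1, h⟩ h'.ne)]
          simp [h', h'.le]
        · simp [hp h]
        · rw [hp h, Finsupp.single_eq_of_ne (inr_ne_inr hu ⟨h1, h⟩ h'.ne')]
          simp [h'.not_ge, h'.not_gt]

theorem linEquiv_bridge_end (a : ℤ) :
    (L.lollipop k).LinEquiv (Finsupp.single ((L.lollipop k).vert 1) a)
      (Finsupp.single ((L.lollipop k).vert 2) a) := by
  have h := (linEquiv_bridge (L := L) (k := k) (L.bridge_pos k) le_rfl).zsmul a
  rwa [Finsupp.smul_single, Finsupp.smul_single, smul_eq_mul, mul_one,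
    show (L.lollipop k).pt 2 (L.bridge k) = (L.lollipop k).vert 2 from
      pt_len (G := L.lollipop k) 2] at h

/-- Points of the bridge can be pushed back to its attaching vertex, so only the loop matters up to
equivalence. -/
theorem exists_linEquiv_loopPt (x : (L.lollipop k).Point) : ∃ s ∈ Set.Icc 0 (L.girth k),
    (L.lollipop k).LinEquiv (Finsupp.single x 1) (Finsupp.single (L.loopPt k s) 1) := by
  have hg := girth_pos (L := L) (k := k)
  have hb := bottom_lt_girth (L := L) (k := k)
  have hb0 := L.bottom_pos k
  rcases x with z | ⟨e, t, ht⟩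
  · match z with
    | 0 => exact ⟨0, ⟨le_rfl, hg.le⟩, by rw [loopPt_zero]; exact .refl _⟩
    | 1 => exact ⟨L.bottom k, ⟨hb0.le, hb.le⟩, by rw [loopPt_bottom]; exact .refl _⟩
    | 2 => exact ⟨L.bottom k, ⟨hb0.le, hb.le⟩, by
        rw [loopPt_bottom]; exact (linEquiv_bridge_end 1).symm⟩
  · match e, ht with
    | 0, ht =>
      have ht2 : t < L.top k := ht.2
      have h1 : L.bottom k < L.girth k - t := by rw [girth]; linarith
      have h2 : L.girth k - t < L.girth k := by linarith [ht.1]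
      refine ⟨L.girth k - t, ⟨(hb0.trans h1).le, h2.le⟩, ?_⟩
      rw [loopPt_of_bottom_lt h1 h2]
      simp only [sub_sub_cancel]
      exact .refl _
    | 1, ht =>
      have ht2 : t < L.bottom k := ht.2
      refine ⟨t, ⟨ht.1.le, (ht2.trans hb).le⟩, ?_⟩
      rw [loopPt_of_lt_bottom ht.1 ht2]
      exact .refl _
    | 2, ht =>
      refine ⟨L.bottom k, ⟨hb0.le, hb.le⟩, ?_⟩
      rw [loopPt_bottom]
      have h := (linEquiv_bridge (L := L) (k := k) ht.1 (le_of_lt ht.2)).symm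
      rwa [pt_of_mem 2 ht] at h

theorem exists_linEquiv_mapDomain_loopPt (A : (L.lollipop k).Divisor) : ∃ n : ℝ →₀ ℤ,
    (∀ s ∈ n.support, s ∈ Set.Icc 0 (L.girth k)) ∧ (n.sum fun _ a => a) = degree A ∧
    (L.lollipop k).LinEquiv A (n.mapDomain (L.loopPt k)) := by
  classical
  induction A using Finsupp.induction_linear with
  | zero => exact ⟨0, by simp, rfl, by simpa using LinEquiv.refl _⟩
  | add A B hA hB =>
    obtain ⟨n, h1, h2, h3⟩ := hA
    obtain ⟨n', h1', h2', h3'⟩ := hB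
    refine ⟨n + n', fun s hs => ?_, ?_, ?_⟩
    · rcases Finset.mem_union.1 (Finsupp.support_add hs) with hs | hs
      exacts [h1 s hs, h1' s hs]
    · rw [degree_add, ← h2, ← h2']
      exact Finsupp.sum_add_index' (fun _ => rfl) fun _ _ _ => rfl
    · rw [Finsupp.mapDomain_add]; exact h3.add h3'
  | single x a =>
    obtain ⟨s, hs, h⟩ := exists_linEquiv_loopPt x
    refine ⟨Finsupp.single s a, fun u hu => ?_, ?_, ?_⟩
    · rwa [Finset.mem_singleton.1 (Finsupp.support_single_subset hu)]
    · rw [degree_single, Finsupp.sum_single_index rfl]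
    · have := h.zsmul a
      rwa [Finsupp.smul_single, Finsupp.smul_single, smul_eq_mul, mul_one,
        ← Finsupp.mapDomain_single] at this

/-- The case of genus one of the Riemann--Roch theorem. -/
theorem exists_effective (A : (L.lollipop k).Divisor) (hA : 1 ≤ degree A) :
    ∃ B, 0 ≤ B ∧ (L.lollipop k).LinEquiv A B := by
  classical
  have hg := girth_pos (L := L) (k := k)
  obtain ⟨n, h1, h2, h3⟩ := exists_linEquiv_mapDomain_loopPt A
  set μ := n.sum fun s a => (a : ℝ) * s with hμ
  set s := toIcoMod hg 0 μ with hs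
  have hs' : s ∈ Set.Icc 0 (L.girth k) := by
    have := toIcoMod_mem_Ico' hg μ
    exact ⟨this.1, this.2.le⟩
  -- All chips but one are put at parameter 0, where they do not affect the moment; the last one
  -- carries the moment modulo the girth.
  refine ⟨Finsupp.single ((L.lollipop k).vert 0) (degree A - 1) +
    Finsupp.single (L.loopPt k s) 1, ?_, h3.trans ?_⟩
  · exact add_nonneg (Finsupp.single_nonneg.2 (by omega)) (Finsupp.single_nonneg.2 (by omega))
  refine LinEquiv.of_sub ?_
  have h := linEquiv_zero_of_moment_eq_mul_girth (L := L) (k := k)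
    (n + (Finsupp.single 0 (-(degree A - 1)) + Finsupp.single s (-1))) (fun u hu => ?_) ?_
    (toIcoDiv hg 0 μ) ?_
  · rw [Finsupp.mapDomain_add, Finsupp.mapDomain_add, Finsupp.mapDomain_single,
      Finsupp.mapDomain_single, loopPt_zero] at h
    rwa [sub_eq_add_neg, neg_add, ← Finsupp.single_neg, ← Finsupp.single_neg]
  · rcases Finset.mem_union.1 (Finsupp.support_add hu) with hu | hu
    · exact h1 u hu
    rcases Finset.mem_union.1 (Finsupp.support_add hu) with hu | hu
    · rw [Finset.mem_singleton.1 (Finsupp.support_single_subset hu)]; exact ⟨le_rfl, hg.le⟩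
    · rwa [Finset.mem_singleton.1 (Finsupp.support_single_subset hu)]
  · rw [Finsupp.sum_add_index' (fun _ => rfl) fun _ _ _ => rfl,
      Finsupp.sum_add_index' (fun _ => rfl) fun _ _ _ => rfl, h2,
      Finsupp.sum_single_index rfl, Finsupp.sum_single_index rfl]
    ring
  · rw [Finsupp.sum_add_index' (by simp) (by intros; push_cast; ring),
      Finsupp.sum_add_index' (by simp) (by intros; push_cast; ring), ← hμ,
      Finsupp.sum_single_index (by simp), Finsupp.sum_single_index (by simp), hs]
    have := toIcoMod_add_toIcoDiv_zsmul hg 0 μ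
    rw [zsmul_eq_mul] at this
    push_cast
    linarith

/-! ### Transport and rigidity of a chip on a loop -/

/-- The position on the loop of the point equivalent to `N w_k - (N - 1) v_k`. -/
noncomputable def loopPos (L : ChainLengths) (k : ℕ) (N : ℤ) : ℝ :=
  if 0 ≤ N then N * L.bottom k else L.girth k + N * L.bottom k

theorem loopPos_mem {K N : ℤ} (hK : K * L.bottom k < L.top k) (hN : |N| ≤ K) :
    L.loopPos k N ∈ Set.Icc 0 (L.girth k) := by
  have hb := L.bottom_pos k
  have h1 : ((|N| : ℤ) : ℝ) * L.bottom k ≤ K * L.bottom k :=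
    mul_le_mul_of_nonneg_right (by exact_mod_cast hN) hb.le
  push_cast at h1
  have h2 := mul_le_mul_of_nonneg_right (neg_le_abs (N : ℝ)) hb.le
  have h3 := mul_le_mul_of_nonneg_right (le_abs_self (N : ℝ)) hb.le
  have h4 : 0 ≤ |(N : ℝ)| * L.bottom k := by positivity
  rw [loopPos]
  split_ifs with h
  · have h : (0 : ℝ) ≤ N := by exact_mod_cast h
    exact ⟨by positivity, by rw [girth]; linarith⟩
  · have h : (N : ℝ) < 0 := by exact_mod_cast not_le.1 h
    have : (N : ℝ) * L.bottom k < 0 := mul_neg_of_neg_of_pos h hb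
    constructor <;> rw [girth] <;> linarith

/-- Most multiples are in the interior of the top edge. -/
theorem exists_loopPt_loopPos {K N : ℤ} (hK : K * L.bottom k < L.top k) (hN : |N| ≤ K)
    (h0 : N ≠ 0) (h1 : N ≠ 1) : ∃ t : ℝ, ∃ ht : t ∈ Set.Ioo 0 ((L.lollipop k).len 0),
      L.loopPt k (L.loopPos k N) = Sum.inr ⟨0, ⟨t, ht⟩⟩ := by
  have hb := L.bottom_pos k
  have e1 : ((|N| : ℤ) : ℝ) * L.bottom k ≤ K * L.bottom k :=
    mul_le_mul_of_nonneg_right (by exact_mod_cast hN) hb.le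
  push_cast at e1
  have e2 := mul_le_mul_of_nonneg_right (neg_le_abs (N : ℝ)) hb.le
  have e3 := mul_le_mul_of_nonneg_right (le_abs_self (N : ℝ)) hb.le
  suffices h : L.bottom k < L.loopPos k N ∧ L.loopPos k N < L.girth k from
    ⟨_, girth_sub_mem h.1 h.2, loopPt_of_bottom_lt h.1 h.2⟩
  rw [loopPos]
  split_ifs with h
  · have h : (2 : ℝ) ≤ N := by exact_mod_cast (show 2 ≤ N by omega)
    have := mul_le_mul_of_nonneg_right h hb.le
    exact ⟨by linarith, by rw [girth]; linarith⟩
  · have h : (N : ℝ) < 0 := by exact_mod_cast not_le.1 h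
    have : (N : ℝ) * L.bottom k < 0 := mul_neg_of_neg_of_pos h hb
    constructor <;> rw [girth] <;> linarith

/-- Moving `c` chips across the loop. -/
theorem linEquiv_loop {K N c : ℤ} (hK : K * L.bottom k < L.top k) (hN : |N| ≤ K)
    (hc : |N - c| ≤ K) :
    (L.lollipop k).LinEquiv
      (Finsupp.single ((L.lollipop k).vert 0) c + Finsupp.single (L.loopPt k (L.loopPos k N)) 1)
      (Finsupp.single ((L.lollipop k).vert 1) c +
        Finsupp.single (L.loopPt k (L.loopPos k (N - c))) 1) := by
  classical
  have hg := girth_pos (L := L) (k := k)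
  have hb := bottom_lt_girth (L := L) (k := k)
  refine LinEquiv.of_sub ?_
  -- Modulo the girth, the point with index `M` has position `M` times the bottom length. The
  -- moments then agree because c · 0 + N = c + (N - c).
  have hpos : ∀ M, ∃ j : ℤ, L.loopPos k M = j * L.girth k + M * L.bottom k := by
    intro M
    rw [loopPos]
    split_ifs
    · exact ⟨0, by simp⟩
    · exact ⟨1, by simp⟩
  obtain ⟨i, hi⟩ := hpos N
  obtain ⟨j, hj⟩ := hpos (N - c)
  have h := linEquiv_zero_of_moment_eq_mul_girth (L := L) (k := k)
    (Finsupp.single 0 c + Finsupp.single (L.loopPos k N) 1 + Finsupp.single (L.bottom k) (-c) +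
      Finsupp.single (L.loopPos k (N - c)) (-1)) (fun u hu => ?_) ?_ (i - j) ?_
  · simp only [Finsupp.mapDomain_add, Finsupp.mapDomain_single, loopPt_zero, loopPt_bottom] at h
    rwa [sub_eq_add_neg, neg_add, ← Finsupp.single_neg, ← Finsupp.single_neg, ← add_assoc]
  · rcases Finset.mem_union.1 (Finsupp.support_add hu) with hu | hu
    · rcases Finset.mem_union.1 (Finsupp.support_add hu) with hu | hu
      · rcases Finset.mem_union.1 (Finsupp.support_add hu) with hu | hu
        · rw [Finset.mem_singleton.1 (Finsupp.support_single_subset hu)]; exact ⟨le_rfl, hg.le⟩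
        · rw [Finset.mem_singleton.1 (Finsupp.support_single_subset hu)]
          exact loopPos_mem hK hN
      · rw [Finset.mem_singleton.1 (Finsupp.support_single_subset hu)]
        exact ⟨(L.bottom_pos k).le, hb.le⟩
    · rw [Finset.mem_singleton.1 (Finsupp.support_single_subset hu)]
      exact loopPos_mem hK hc
  · simp only [Finsupp.sum_add_index' (h := fun (_ : ℝ) (a : ℤ) => a) (fun _ => rfl)
      fun _ _ _ => rfl]
    simp only [Finsupp.sum_single_index]
    ring
  · simp only [Finsupp.sum_add_index' (h := fun (s : ℝ) (a : ℤ) => (a : ℝ) * s) (by simp)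
      (by intros; push_cast; ring)]
    simp only [Finsupp.sum_single_index, Int.cast_zero, zero_mul, hi, hj]
    push_cast
    ring

/-- The lollipop has no function with a single pole, in the interior of the top edge. -/
theorem ord_eq_zero_of_single_pole {f : (L.lollipop k).Point → ℝ} (hf : (L.lollipop k).IsPL f)
    {t : ℝ} (ht : t ∈ Set.Ioo 0 ((L.lollipop k).len 0))
    (hq : -1 ≤ (L.lollipop k).ord f (Sum.inr ⟨0, ⟨t, ht⟩⟩))
    (hpos : ∀ x, x ≠ Sum.inr ⟨0, ⟨t, ht⟩⟩ → 0 ≤ (L.lollipop k).ord f x) (x : (L.lollipop k).Point) :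
    (L.lollipop k).ord f x = 0 := by
  have ht1 : 0 < t := ht.1
  have ht2 : t < L.top k := ht.2
  have P0 : PLOn (fun u => f ((L.lollipop k).pt 0 u)) 0 (L.top k) := hf.plOn 0
  have P1 : PLOn (fun u => f ((L.lollipop k).pt 1 u)) 0 (L.bottom k) := hf.plOn 1
  have P2 : PLOn (fun u => f ((L.lollipop k).pt 2 u)) 0 (L.bridge k) := hf.plOn 2
  have hm := L.bottom_pos k
  have hn := L.bridge_pos k
  have Q0 := P0.mono le_rfl ht2.le
  have Q1 := P0.mono ht1.le le_rfl
  have c0 : ∀ u, 0 < u → u < t → rightSlope (fun u => f ((L.lollipop k).pt 0 u)) u +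
      leftSlope (fun u => f ((L.lollipop k).pt 0 u)) u ≤ 0 := fun u h1 h2 =>
    neg_nonneg.1 (hpos (Sum.inr ⟨0, ⟨u, h1, h2.trans ht2⟩⟩) (inr_ne_inr _ _ h2.ne))
  have c1 : ∀ u, t < u → u < L.top k → rightSlope (fun u => f ((L.lollipop k).pt 0 u)) u +
      leftSlope (fun u => f ((L.lollipop k).pt 0 u)) u ≤ 0 := fun u h1 h2 =>
    neg_nonneg.1 (hpos (Sum.inr ⟨0, ⟨u, ht1.trans h1, h2⟩⟩) (inr_ne_inr _ _ h1.ne'))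
  have cb : ∀ u, 0 < u → u < L.bottom k → rightSlope (fun u => f ((L.lollipop k).pt 1 u)) u +
      leftSlope (fun u => f ((L.lollipop k).pt 1 u)) u ≤ 0 := fun u h1 h2 =>
    neg_nonneg.1 (hpos (Sum.inr ⟨1, ⟨u, h1, h2⟩⟩) (by simp))
  have ct : ∀ u, 0 < u → u < L.bridge k → rightSlope (fun u => f ((L.lollipop k).pt 2 u)) u +
      leftSlope (fun u => f ((L.lollipop k).pt 2 u)) u ≤ 0 := fun u h1 h2 =>
    neg_nonneg.1 (hpos (Sum.inr ⟨2, ⟨u, h1, h2⟩⟩) (by simp))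
  obtain ⟨o0, o1, o2⟩ := ord_lollipop f
  have e0 := hpos (Sum.inl 0) (by simp)
  have e1 := hpos (Sum.inl 1) (by simp)
  have e2 := hpos (Sum.inl 2) (by simp)
  rw [o0] at e0
  rw [o1] at e1
  rw [o2] at e2
  have e3 : -1 ≤ -(rightSlope (fun u => f ((L.lollipop k).pt 0 u)) t +
    leftSlope (fun u => f ((L.lollipop k).pt 0 u)) t) := hq
  -- The pole cuts the top edge in two; with the bottom edge and the bridge this gives four segments
  -- on which `f` is concave.
  have s0 := Q0.slopes_nonneg ht1 c0
  have s1 := Q1.slopes_nonneg ht2 c1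
  have s2 := P1.slopes_nonneg hm cb
  have s3 := P2.slopes_nonneg hn ct
  -- the tangents at the ends of the segments
  have a0 := Q0.right le_rfl ht1
  have b0 := Q0.left ht1 le_rfl
  have a1 := Q1.right le_rfl ht2
  have b1 := Q1.left ht2 le_rfl
  have a2 := P1.right le_rfl hm
  have b2 := P1.left hm le_rfl
  have a3 := P2.right le_rfl hn
  have b3 := P2.left hn le_rfl
  set φ0 : ℝ → ℝ := fun u => f ((L.lollipop k).pt 0 u) with hφ0
  set φ1 : ℝ → ℝ := fun u => f ((L.lollipop k).pt 1 u) with hφ1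
  set φ2 : ℝ → ℝ := fun u => f ((L.lollipop k).pt 2 u) with hφ2
  have v0 : φ0 0 = f (Sum.inl 0) := congrArg f (pt_zero _)
  have v1 : φ1 0 = f (Sum.inl 0) := congrArg f (pt_zero _)
  have w0 : φ0 (L.top k) = f (Sum.inl 1) := congrArg f (pt_len (G := L.lollipop k) 0)
  have w1 : φ1 (L.bottom k) = f (Sum.inl 1) := congrArg f (pt_len (G := L.lollipop k) 1)
  have w2 : φ2 0 = f (Sum.inl 1) := congrArg f (pt_zero _)
  have T0 := fun u => Q0.le_right_tangent c0 a0 (u := u)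
  have T0' := fun u => Q0.le_left_tangent c0 b0 (u := u)
  have T1 := fun u => Q1.le_right_tangent c1 a1 (u := u)
  have T1' := fun u => Q1.le_left_tangent c1 b1 (u := u)
  have T2 := fun u => P1.le_right_tangent cb a2 (u := u)
  have T2' := fun u => P1.le_left_tangent cb b2 (u := u)
  have T3 := fun u => P2.le_right_tangent ct a3 (u := u)
  have T3' := fun u => P2.le_left_tangent ct b3 (u := u)
  have key : rightSlope φ0 0 = 0 ∧ leftSlope φ0 (L.top k) = 0 ∧ rightSlope φ1 0 = 0 ∧
      rightSlope φ2 0 = 0 ∧ leftSlope φ2 (L.bridge k) = 0 ∧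
      f (Sum.inl 1) = f (Sum.inl 0) ∧ φ0 t = f (Sum.inl 0) := by
    have pos : ∀ (a : ℤ) (z : ℝ), 0 < z → a ≤ 0 → (a : ℝ) * z ≤ 0 ∧ ((a : ℝ) * z = 0 → a = 0) := by
      intro a z hz ha
      refine ⟨mul_nonpos_of_nonpos_of_nonneg (by exact_mod_cast ha) hz.le, fun h => ?_⟩
      have := (mul_eq_zero.1 h).resolve_right hz.ne'
      exact_mod_cast this
    have hy : 0 < L.top k - t := sub_pos.2 ht2
    -- The outgoing slopes at the pole are integers with sum at most 1, so one of them is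
    -- nonpositive. Starting in that direction, the inequalities at vertices and segments make `f`
    -- nonincreasing all around the loop. Since it returns to its initial value, all these slopes
    -- vanish.
    rcases le_or_gt (rightSlope φ0 t) 0 with h | h
    · have i1 := T1 (L.top k) ht2.le le_rfl
      have i2 := T2' 0 le_rfl hm.le
      have i3 := T0 t ht1.le le_rfl
      have p1 := pos _ _ hy h
      have p2 := pos (leftSlope φ1 (L.bottom k)) (L.bottom k) hm (by omega)
      have p3 := pos (rightSlope φ0 0) t ht1 (by omega)
      rw [sub_zero] at i2 i3
      have q1 := p1.2 (by linarith)
      have q2 := p2.2 (by linarith)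
      have q3 := p3.2 (by linarith)
      rw [q1] at i1
      rw [q2] at i2
      rw [q3] at i3
      simp only [Int.cast_zero, zero_mul, add_zero] at i1 i2 i3
      exact ⟨q3, by omega, by omega, by omega, by omega, by linarith, by linarith⟩
    · have i1 := T0' 0 le_rfl ht1.le
      have i2 := T2 (L.bottom k) hm.le le_rfl
      have i3 := T1' t le_rfl ht2.le
      have p1 := pos (leftSlope φ0 t) t ht1 (by omega)
      have p2 := pos (rightSlope φ1 0) (L.bottom k) hm (by omega)
      have p3 := pos (leftSlope φ0 (L.top k)) (L.top k - t) hy (by omega)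
      rw [sub_zero] at i2 i1
      have q1 := p1.2 (by linarith)
      have q2 := p2.2 (by linarith)
      have q3 := p3.2 (by linarith)
      rw [q1] at i1
      rw [q2] at i2
      rw [q3] at i3
      simp only [Int.cast_zero, zero_mul, add_zero] at i1 i2 i3
      exact ⟨by omega, q3, q2, by omega, by omega, by linarith, by linarith⟩
  obtain ⟨k1, k2, k3, k4, k5, k6, k7⟩ := key
  rw [k1] at T0
  rw [k2] at T1'
  rw [k3] at T2
  rw [k4] at T3
  rw [k5] at T3'
  simp only [Int.cast_zero, zero_mul, add_zero] at T0 T1' T2 T3 T3'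
  -- Vanishing end slopes bound `f` above by its value at the vertices, and concavity bounds it
  -- below by the end values.
  have hconst : f = fun _ => f (Sum.inl 0) := by
    have w3 : φ2 (L.bridge k) = f (Sum.inl 0) := by
      refine le_antisymm ((T3 _ hn.le le_rfl).trans_eq (by rw [w2, k6])) ?_
      rw [← k6, ← w2]; exact T3' 0 le_rfl hn.le
    have val : ∀ e (u : ℝ) (hu : u ∈ Set.Ioo 0 ((L.lollipop k).len e)),
        f (Sum.inr ⟨e, ⟨u, hu⟩⟩) = f ((L.lollipop k).pt e u) := fun e u hu => by
      rw [pt_of_mem e hu]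
    funext y
    rcases y with z | ⟨e, u, hu⟩
    · match z with
      | 0 => rfl
      | 1 => exact k6
      | 2 => exact (congrArg f (pt_len (G := L.lollipop k) 2)).symm.trans w3
    · rw [val]
      have hu1 : 0 < u := hu.1
      match e, hu with
      | 0, hu =>
        have hu2 : u < L.top k := hu.2
        change φ0 u = _
        rcases le_total u t with h | h
        · refine le_antisymm ((T0 u hu1.le h).trans_eq v0) ?_
          have := Q0.min_le c0 hu1.le h
          change min (φ0 0) (φ0 t) ≤ φ0 u at this
          rwa [v0, k7, min_self] at this
        · refine le_antisymm ((T1' u h hu2.le).trans_eq (w0.trans k6)) ?_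
          have := Q1.min_le c1 h hu2.le
          change min (φ0 t) (φ0 (L.top k)) ≤ φ0 u at this
          rwa [w0, k6, k7, min_self] at this
      | 1, hu =>
        have hu2 : u < L.bottom k := hu.2
        refine le_antisymm ((T2 u hu1.le hu2.le).trans_eq v1) ?_
        have := P1.min_le cb hu1.le hu2.le
        change min (φ1 0) (φ1 (L.bottom k)) ≤ φ1 u at this
        rwa [v1, w1, k6, min_self] at this
      | 2, hu =>
        have hu2 : u < L.bridge k := hu.2
        refine le_antisymm ((T3 u hu1.le hu2.le).trans_eq (w2.trans k6)) ?_
        have := P2.min_le ct hu1.le hu2.le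
        change min (φ2 0) (φ2 (L.bridge k)) ≤ φ2 u at this
        rwa [w2, w3, k6, min_self] at this
  rw [hconst, ord_const]

end ChainLengths

/-! ### Harmonic functions and sums of sections -/

namespace MetricGraph

variable {V E : Type} {G : MetricGraph V E} [Fintype E]

/-- Harmonic functions on a connected metric graph are constant. -/
theorem eq_const_of_ord_eq_zero [Finite V] {f : G.Point → ℝ} (hf : G.IsPL f)
    (h : ∀ x, G.ord f x = 0) (x₀ : V)
    (hconn : ∀ S : Set V, S.Nonempty → (∀ e, G.src e ∈ S ↔ G.tgt e ∈ S) → S = Set.univ) :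
    ∃ a, f = fun _ => a := by
  classical
  have hR := fun e => (hf.plOn e).right le_rfl (G.len_pos e)
  have hL := fun e => (hf.plOn e).left (G.len_pos e) le_rfl
  have haff : ∀ e u, 0 ≤ u → u ≤ G.len e → f (G.pt e u) = f (G.vert (G.src e)) +
      rightSlope (fun u => f (G.pt e u)) 0 * u := by
    intro e u h1 h2
    have := (hf.plOn e).eq_right_tangent (fun t h3 h4 => ?_) (hR e) h1 h2
    · simpa using this
    · exact neg_eq_zero.1 (h (Sum.inr ⟨e, ⟨t, h3, h4⟩⟩))
  have hRt : ∀ e, f (G.vert (G.tgt e)) = f (G.vert (G.src e)) +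
      rightSlope (fun u => f (G.pt e u)) 0 * G.len e := fun e => by
    simpa using haff e _ (G.len_pos e).le le_rfl
  have hLs : ∀ e, leftSlope (fun u => f (G.pt e u)) (G.len e) =
      -rightSlope (fun u => f (G.pt e u)) 0 := by
    intro e
    refine HasLeftSlope.leftSlope_eq ?_
    filter_upwards [Ioo_mem_nhdsLT (G.len_pos e)] with u hu
    rw [haff e u hu.1.le hu.2.le, haff e _ (G.len_pos e).le le_rfl]
    push_cast; ring
  have : Nonempty V := ⟨x₀⟩
  -- Maximum principle: `f` is affine on edges, so at a vertex with maximal value no outgoing slope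
  -- is positive, and their vanishing sum makes each of them zero.
  obtain ⟨z, hz⟩ := Finite.exists_max fun z => f (G.vert z)
  have hsrc : ∀ e, f (G.vert (G.src e)) = f (G.vert z) →
      rightSlope (fun u => f (G.pt e u)) 0 ≤ 0 := by
    intro e he
    by_contra! hc
    have hc : (0 : ℝ) < rightSlope (fun u => f (G.pt e u)) 0 := by exact_mod_cast hc
    have := mul_pos hc (G.len_pos e)
    have := hz (G.tgt e)
    rw [hRt] at this
    linarith
  have htgt : ∀ e, f (G.vert (G.tgt e)) = f (G.vert z) →
      leftSlope (fun u => f (G.pt e u)) (G.len e) ≤ 0 := by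
    intro e he
    rw [hLs]
    by_contra! hc
    have hc : (rightSlope (fun u => f (G.pt e u)) 0 : ℝ) < 0 := by
      exact_mod_cast (by omega : rightSlope (fun u => f (G.pt e u)) 0 < 0)
    have := mul_neg_of_neg_of_pos hc (G.len_pos e)
    have h1 := hz (G.src e)
    rw [hRt] at he
    linarith
  have hzero : ∀ y, f (G.vert y) = f (G.vert z) →
      (∀ e, G.src e = y → rightSlope (fun u => f (G.pt e u)) 0 = 0) ∧
      ∀ e, G.tgt e = y → leftSlope (fun u => f (G.pt e u)) (G.len e) = 0 := by
    intro y hy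
    have hy0 := h (G.vert y)
    simp only [ord] at hy0
    have n1 : ∀ e ∈ Finset.univ,
        (if G.src e = y then rightSlope (fun u => f (G.pt e u)) 0 else 0) ≤ 0 := by
      intro e _
      split_ifs with hs
      · exact hsrc e (by rw [hs, hy])
      · exact le_rfl
    have n2 : ∀ e ∈ Finset.univ,
        (if G.tgt e = y then leftSlope (fun u => f (G.pt e u)) (G.len e) else 0) ≤ 0 := by
      intro e _
      split_ifs with hs
      · exact htgt e (by rw [hs, hy])
      · exact le_rfl
    have m1 := Finset.sum_nonpos n1
    have m2 := Finset.sum_nonpos n2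
    have z1 := (Finset.sum_eq_zero_iff_of_nonpos n1).1 (le_antisymm m1 (by omega))
    have z2 := (Finset.sum_eq_zero_iff_of_nonpos n2).1 (le_antisymm m2 (by omega))
    refine ⟨fun e he => ?_, fun e he => ?_⟩
    · simpa [he] using z1 e (Finset.mem_univ e)
    · simpa [he] using z2 e (Finset.mem_univ e)
  have hall := hconn {y | f (G.vert y) = f (G.vert z)} ⟨z, rfl⟩ fun e => by
    constructor
    · intro he
      have := (hzero _ he).1 e rfl
      change _ = _
      rw [hRt, this]
      simpa using he
    · intro he
      have := (hzero _ he).2 e rfl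
      rw [hLs, neg_eq_zero] at this
      have he : f (G.vert (G.tgt e)) = f (G.vert z) := he
      rw [hRt, this] at he
      simpa using he
  have hall : ∀ y, f (G.vert y) = f (G.vert z) := fun y => by
    have : y ∈ {y | f (G.vert y) = f (G.vert z)} := hall ▸ Set.mem_univ y
    exact this
  refine ⟨f (G.vert z), ?_⟩
  funext x
  rcases x with y | ⟨e, u, hu⟩
  · exact hall y
  · have := haff e u hu.1.le hu.2.le
    rwa [pt_of_mem e hu, (hzero _ (hall _)).1 e rfl, hall, Int.cast_zero, zero_mul, add_zero]
      at this

/-- For a multiset `I` of size `m` the sum of the `φ i` is thus an admissible choice of `ψ_I`, one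
whose restriction to a subgraph is evident. -/
theorem moves_multiset_sum {ι : Type} {φ : ι → G.Point → ℝ} {D : G.Divisor} {Di : ι → G.Divisor}
    (h : ∀ i, G.Moves (φ i) D (Di i)) (I : Multiset ι) :
    G.Moves (fun x => (I.map fun i => φ i x).sum) (I.card • D) (I.map Di).sum := by
  induction I using Multiset.induction_on with
  | empty => simpa using moves_const 0 0
  | cons i I ih =>
    simp only [Multiset.map_cons, Multiset.sum_cons, Multiset.card_cons, succ_nsmul']
    exact (h i).add ih

end MetricGraph

/-! ### Chains as iterated wedges and the induction step -/

namespace ChainLengths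

open MetricGraph

theorem chain_connected (L : ChainLengths) (g : ℕ) (S : Set (Vertex g)) (hS : S.Nonempty)
    (h : ∀ e, (L.chain g).src e ∈ S ↔ (L.chain g).tgt e ∈ S) : S = Set.univ := by
  have h1 : ∀ k : Fin (g + 1), (Sum.inl k ∈ S ↔ Sum.inr k ∈ S) := fun k => h (Sum.inl k)
  have h2 : ∀ k : Fin g, (Sum.inr k.castSucc ∈ S ↔ Sum.inl k.succ ∈ S) :=
    fun k => h (Sum.inr (Sum.inl k))
  have h3 : ∀ k : Fin (g + 1), (Sum.inl k ∈ S ↔ Sum.inl 0 ∈ S) := by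
    intro k
    induction k using Fin.induction with
    | zero => rfl
    | succ k ih => rw [← h2, ← h1, ih]
  have h4 : Sum.inl 0 ∈ S := by
    obtain ⟨k | k, hk⟩ := hS
    · exact (h3 k).1 hk
    · exact (h3 k).1 ((h1 k).2 hk)
  ext z
  rcases z with k | k
  · simp [h3, h4]
  · simp [← h1, h3, h4]

/-- The chain of `g + 1` loops arises from the chain of `g` loops by attaching one loop with a
bridge. -/
def chainWedge (L : ChainLengths) (g : ℕ) :
    Wedge (L.chain g) (L.lollipop (g + 1)) (L.chain (g + 1)) (Sum.inr (Fin.last g)) 0 where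
  left :=
    { onV := Sum.map Fin.castSucc Fin.castSucc
      onE := Sum.map Fin.castSucc (Sum.map Fin.castSucc Fin.castSucc)
      onV_inj := (Fin.castSucc_injective _).sumMap (Fin.castSucc_injective _)
      onE_inj := (Fin.castSucc_injective _).sumMap
        ((Fin.castSucc_injective _).sumMap (Fin.castSucc_injective _))
      src := by rintro (e | e | e) <;> rfl
      tgt := by rintro (e | e | e) <;> rfl
      len := by rintro (e | e | e) <;> rfl }
  right :=
    { onV := fun
        | 0 => Sum.inr (Fin.last g).castSucc
        | 1 => Sum.inl (Fin.last (g + 1))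
        | 2 => Sum.inr (Fin.last (g + 1))
      onE := fun
        | 0 => Sum.inr (Sum.inl (Fin.last g))
        | 1 => Sum.inr (Sum.inr (Fin.last g))
        | 2 => Sum.inl (Fin.last (g + 1))
      onV_inj := by
        intro x y h
        fin_cases x <;> fin_cases y <;> simp_all [Fin.ext_iff]
      onE_inj := by
        intro x y h
        fin_cases x <;> fin_cases y <;> simp_all
      src := by intro e; match e with | 0 => rfl | 1 => rfl | 2 => rfl
      tgt := by intro e; match e with | 0 => rfl | 1 => rfl | 2 => rfl
      len := by intro e; match e with | 0 => rfl | 1 => rfl | 2 => rfl }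
  vert_eq_iff := by
    rintro (x | x) y <;> fin_cases y <;> simp [Fin.ext_iff] <;> omega
  edge_ne := by
    rintro (e | e | e) e' <;> fin_cases e' <;> simp [Fin.ext_iff] <;> omega
  cover_vert := by
    rintro (z | z)
    · induction z using Fin.lastCases with
      | last => exact Or.inr ⟨1, rfl⟩
      | cast z => exact Or.inl ⟨Sum.inl z, rfl⟩
    · induction z using Fin.lastCases with
      | last => exact Or.inr ⟨2, rfl⟩
      | cast z => exact Or.inl ⟨Sum.inr z, rfl⟩
  cover_edge := by
    rintro (z | z | z)
    · induction z using Fin.lastCases with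
      | last => exact Or.inr ⟨2, rfl⟩
      | cast z => exact Or.inl ⟨Sum.inl z, rfl⟩
    · induction z using Fin.lastCases with
      | last => exact Or.inr ⟨0, rfl⟩
      | cast z => exact Or.inl ⟨Sum.inr (Sum.inl z), rfl⟩
    · induction z using Fin.lastCases with
      | last => exact Or.inr ⟨1, rfl⟩
      | cast z => exact Or.inl ⟨Sum.inr (Sum.inr z), rfl⟩
  sum_eq F := by
    simp only [Fintype.sum_sum_type, Fin.sum_univ_three]
    rw [Fin.sum_univ_castSucc (n := g + 1), Fin.sum_univ_castSucc fun i => F (Sum.inr (Sum.inl i)),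
      Fin.sum_univ_castSucc fun i => F (Sum.inr (Sum.inr i))]
    simp only [Sum.map_inl, Sum.map_inr]
    ring

/-- The chain of `g` loops carries a series with multiplicities `c` at the right end, on a divisor
of degree `d`, such that the sums of `m` of its functions are tropically independent. -/
def HasIndependentSeries (L : ChainLengths) (g r m : ℕ) (c : Fin (r + 1) → ℤ) (d : ℤ) : Prop :=
  ∃ D Di φ, degree D = d ∧
    (L.chain g).Series (Sum.inl 0) (Sum.inr (Fin.last g)) r D c Di φ ∧
    TropicallyIndependent
      (fun (I : Sym (Fin (r + 1)) m) x => ((I : Multiset (Fin (r + 1))).map fun i => φ i x).sum)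
      Finset.univ

variable {L : ChainLengths} {g r m : ℕ} {c : Fin (r + 1) → ℤ} {d : ℤ}

theorem HasIndependentSeries.add_const (h : L.HasIndependentSeries g r m c d) (k : ℤ) :
    L.HasIndependentSeries g r m (fun i => c i + k) (d + k) := by
  obtain ⟨D, Di, φ, hd, hs, hi⟩ := h
  exact ⟨_, _, φ, by rw [degree_add, degree_single, hd], hs.add_single (by simp) k, hi⟩

/-- The new chip is put at the point of index `N` on the new loop. `hne` keeps the remaining chip
off v, and the bounds by `K` keep it in the top edge unless it reaches w. The gap condition `hc`
feeds the rank condition. -/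
theorem HasIndependentSeries.succ (h : L.HasIndependentSeries g r m c d) {K N : ℤ}
    (hK : K * L.bottom (g + 1) < L.top (g + 1)) (hN : |N| ≤ K) (hNc : ∀ i, |N - c i| ≤ K)
    (hne : ∀ i, N ≠ c i) (hc : ∀ i j : Fin (r + 1), i < j → c j + ((j : ℤ) - i) ≤ c i) :
    L.HasIndependentSeries (g + 1) r m (fun i => if N - c i = 1 then N else c i) (d + 1) := by
  classical
  obtain ⟨D, Di, φ, hd, hs, hi⟩ := h
  set W := L.chainWedge g
  set q : ℤ → (L.lollipop (g + 1)).Point := fun M => L.loopPt (g + 1) (L.loopPos (g + 1) M)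
    with hq
  have hq1 : q 1 = (L.lollipop (g + 1)).vert 1 := by
    simp only [hq, loopPos]
    simpa using loopPt_bottom
  have hqt : ∀ i, N - c i ≠ 1 → ∃ t : ℝ, ∃ ht : t ∈ Set.Ioo 0 ((L.lollipop (g + 1)).len 0),
      q (N - c i) = Sum.inr ⟨0, ⟨t, ht⟩⟩ := fun i h1 =>
    exists_loopPt_loopPos hK (hNc i) (sub_ne_zero.2 (hne i)) h1
  obtain ⟨Di', φ', hs', hφ'⟩ := W.exists_series (t := 2)
    (c' := fun i => if N - c i = 1 then N else c i) hs (by simp) (by simp) (q N)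
    (fun i => if N - c i = 1 then 0 else Finsupp.single (q (N - c i)) 1)
    (fun i => by
      split_ifs
      · exact le_rfl
      · exact Finsupp.single_nonneg.2 zero_le_one)
    (fun i z => by
      split_ifs with h1
      · rfl
      · obtain ⟨t, ht, e⟩ := hqt i h1
        rw [e]; exact Finsupp.single_eq_of_ne (by simp))
    (fun i => by
      refine (linEquiv_loop hK hN (hNc i)).trans ?_
      split_ifs with h1
      -- The chip has arrived at w and joins the `c i` others, so `N = c i + 1` chips cross the
      -- bridge.
      · rw [h1]
        change (L.lollipop (g + 1)).LinEquiv (_ + Finsupp.single (q 1) 1) _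
        rw [hq1, ← Finsupp.single_add, zero_add, show c i + 1 = N by omega]
        exact linEquiv_bridge_end N
      · rw [add_comm (Finsupp.single _ _)]
        exact (LinEquiv.refl _).add (linEquiv_bridge_end (c i)))
    (fun i f hf hpos x => by
      obtain ⟨t, ht, hle⟩ : ∃ t : ℝ, ∃ ht : t ∈ Set.Ioo 0 ((L.lollipop (g + 1)).len 0),
          ∀ x, (if N - c i = 1 then (0 : (L.lollipop (g + 1)).Divisor) else
            Finsupp.single (q (N - c i)) 1) x ≤
            (Finsupp.single (Sum.inr ⟨0, ⟨t, ht⟩⟩) 1 : (L.lollipop (g + 1)).Divisor) x := by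
        split_ifs with h1
        -- No chip stays on the loop, so any interior point can play the role of the pole; the
        -- midpoint is taken.
        · have h0 := (L.lollipop (g + 1)).len_pos 0
          refine ⟨_, ⟨half_pos h0, half_lt_self h0⟩, ?_⟩
          exact Finsupp.single_nonneg.2 zero_le_one
        · obtain ⟨t, ht, e⟩ := hqt i h1
          exact ⟨t, ht, fun x => by rw [e]⟩
      refine ord_eq_zero_of_single_pole hf ht ?_ (fun y hy => ?_) x
      · have h1 := hpos (Sum.inr ⟨0, ⟨t, ht⟩⟩)
        have h2 := hle (Sum.inr ⟨0, ⟨t, ht⟩⟩)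
        rw [Finsupp.single_eq_same] at h2
        omega
      · have h1 := hpos y
        have h2 := hle y
        rw [Finsupp.single_eq_of_ne hy] at h2
        omega)
    (fun A hA => exists_effective A hA)
    (fun i j hij => by
      have h1 := hc i j hij
      split_ifs with h2
      -- The multiplicity of `j` rises to `N`, one above `c j`. Since `N` differs from the
      -- multiplicity of index j - 1, the gap just before `j` was at least 2 and can afford this.
      · have hji : (i : ℕ) < j := hij
        rcases (Nat.succ_le_of_lt hji).eq_or_lt with h3 | h3
        · have := hne i
          omega
        · have hj := j.2
          have h4 := hc i ⟨j - 1, by omega⟩ (Fin.lt_def.2 (by simp only; omega))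
          have h5 := hc ⟨j - 1, by omega⟩ j (Fin.lt_def.2 (by simp only; omega))
          have h6 := hne ⟨j - 1, by omega⟩
          have h7 : (((j : ℕ) - 1 : ℕ) : ℤ) = (j : ℤ) - 1 := by omega
          simp only [h7] at h4 h5
          omega
      · exact h1)
  refine ⟨_, Di', φ', ?_, hs', ?_⟩
  · rw [degree_add, Sub.degree_push, degree_single, hd]
  -- The new functions restrict to the old ones on the left part, so a dependence restricts with the
  -- same constants.
  · rintro ⟨a, ha⟩
    refine hi ⟨a, fun x => ?_⟩
    have := ha (W.left.map x)
    simpa only [← hφ', Function.comp_apply] using this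

/-- An integral relation among the first bottom lengths becomes one among all of them by zero
coefficients. The other conditions for the shorter chain are among, or weaker than, those for the
longer one. -/
theorem Admissible.mono {g' b : ℕ} {C : ℝ} (h : L.Admissible g' r b C) (hg : g ≤ g') :
    L.Admissible g r b C := by
  have hsub : Finset.Icc 1 g ⊆ Finset.Icc 1 g' := Finset.Icc_subset_Icc_right hg
  have hg' : (g : ℝ) ≤ g' := by exact_mod_cast hg
  refine ⟨fun k hk => ?_, fun k hk => h.2.1 k (hsub hk), fun c hc hsum k hk => ?_,
    fun α h1 h2 => h.2.2.2 α h1 (h2.trans hg)⟩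
  · have h1 := h.1 k (hsub hk)
    have h2 := mul_le_mul_of_nonneg_right hg' (L.bottom_pos k).le
    linarith
  · have h3 := h.2.2.1 (fun k => if k ∈ Finset.Icc 1 g then c k else 0) (fun k _ => ?_) ?_ k (hsub hk)
    · simpa only [if_pos hk] using h3
    · split_ifs with h4
      · have := hc k h4
        omega
      · simp; omega
    · rw [← Finset.sum_subset hsub, ← hsum]
      · exact Finset.sum_congr rfl fun k hk => by rw [if_pos hk]
      · intro k _ hk
        rw [if_neg hk, Int.cast_zero, zero_mul]

end ChainLengths

/-! ### Vertex avoiding divisors as series -/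

namespace ChainLengths

open MetricGraph

variable {L : ChainLengths} {g r s ρ m : ℕ}

/-- Effectivity at the right end already follows from the bound r - i ≥ 0, which brings sections
into the form used in `Series`. -/
theorem isSection_iff {D : (L.chain g).Divisor} {i : Fin (r + 1)} {F : (L.chain g).Divisor} :
    L.IsSection g r D i F ↔ (L.chain g).LinEquiv D F ∧
      (∀ p, p ≠ (L.chain g).vert (Sum.inr (Fin.last g)) → 0 ≤ F p) ∧
      (i : ℤ) ≤ F ((L.chain g).vert (Sum.inl 0)) ∧
      (r : ℤ) - i ≤ F ((L.chain g).vert (Sum.inr (Fin.last g))) := by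
  have hxy : L.leftEnd g ≠ L.rightEnd g := by simp [leftEnd, rightEnd]
  have hi := i.2
  change (_ ∧ _ ∧ _) ↔ (_ ∧ (∀ p, p ≠ L.rightEnd g → 0 ≤ F p) ∧ (i : ℤ) ≤ F (L.leftEnd g) ∧
    (r : ℤ) - i ≤ F (L.rightEnd g))
  refine and_congr_right fun _ => ⟨fun ⟨h1, h2⟩ => ⟨fun p _ => h2 p, ?_, ?_⟩, fun ⟨h1, h2, h3⟩ =>
    ⟨fun p => ?_, fun p => ?_⟩⟩
  · simpa [Finsupp.single_eq_of_ne hxy] using h1 (L.leftEnd g)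
  · simpa [Finsupp.single_eq_of_ne hxy.symm] using h1 (L.rightEnd g)
  · by_cases hp : p = L.rightEnd g
    · subst hp; simpa [Finsupp.single_eq_of_ne hxy.symm] using h3
    · rw [Finsupp.add_apply, Finsupp.single_eq_of_ne hp, add_zero]
      by_cases hp' : p = L.leftEnd g
      · subst hp'; simpa using h2
      · rw [Finsupp.single_eq_of_ne hp']; exact h1 p hp
  · by_cases hp : p = L.rightEnd g
    · subst hp; exact show (0 : ℤ) ≤ F (L.rightEnd g) by omega
    · exact h1 p hp

/-- Chips of `F` at the right end, say a of them, are split off. The remaining degree r - a is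
exactly the index whose multiplicity at that end is a. -/
theorem Series.rankGE {D : (L.chain g).Divisor} {Di : Fin (r + 1) → (L.chain g).Divisor}
    {φ : Fin (r + 1) → (L.chain g).Point → ℝ}
    (h : (L.chain g).Series (Sum.inl 0) (Sum.inr (Fin.last g)) r D (fun i => (r : ℤ) - i) Di φ) :
    (L.chain g).RankGE D r := by
  classical
  intro F hF hdeg
  set y := (L.chain g).vert (Sum.inr (Fin.last g)) with hy
  obtain ⟨a, ha⟩ := Int.eq_ofNat_of_zero_le (hF y)
  have hFe : Finsupp.single y (F y) + F.erase y = F := Finsupp.single_add_erase y F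
  have hpos : 0 ≤ F.erase y := fun p => by
    by_cases hp : p = y
    · subst hp; simp
    · rw [Finsupp.erase_ne hp]; exact hF p
  have hdeg' : degree (F.erase y) = (r : ℤ) - a := by
    rw [← hFe, degree_add, degree_single, ha] at hdeg
    omega
  have h0 : 0 ≤ degree (F.erase y) := Finset.sum_nonneg fun p _ => hpos p
  obtain ⟨F', h1, h2, h3⟩ := h.rank ⟨r - a, by omega⟩ (F.erase y) hpos (by
    simp only; omega)
  refine ⟨F' - F, fun p => ?_, by simpa [sub_eq_add_neg] using h1.add_right (-F)⟩
  rw [Finsupp.sub_apply, Finsupp.coe_zero, Pi.zero_apply, sub_nonneg]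
  by_cases hp : p = y
  · subst hp
    simp only [← hy] at h3
    omega
  · have := h2 p hp
    rwa [Finsupp.erase_ne hp] at this

/-- With rank r + 1 there would be a section with r + 1 chips at the right end. By uniqueness it is
the section of index 0, which has only r there. -/
theorem Series.hasRank {D : (L.chain g).Divisor} {Di : Fin (r + 1) → (L.chain g).Divisor}
    {φ : Fin (r + 1) → (L.chain g).Point → ℝ}
    (h : (L.chain g).Series (Sum.inl 0) (Sum.inr (Fin.last g)) r D (fun i => (r : ℤ) - i) Di φ) :
    (L.chain g).HasRank D r := by
  classical
  refine ⟨Series.rankGE h, fun hr => ?_⟩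
  set y := (L.chain g).vert (Sum.inr (Fin.last g)) with hy
  obtain ⟨E, hE, hDE⟩ := hr (Finsupp.single y ((r : ℤ) + 1))
    (Finsupp.single_nonneg.2 (by omega)) (by rw [degree_single]; push_cast; ring)
  have hDE' := hDE.add_right (Finsupp.single y ((r : ℤ) + 1))
  rw [sub_add_cancel] at hDE'
  have hEy : (0 : ℤ) ≤ E y := hE y
  have h1 := h.unique 0 _ hDE' (fun p hp => ?_) ?_ ?_
  · have h2 := h.verts 0 (Sum.inr (Fin.last g))
    rw [← h1] at h2
    simp [← hy] at h2
    omega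
  · rw [Finsupp.add_apply, Finsupp.single_eq_of_ne hp, add_zero]; exact hE p
  · rw [Finsupp.add_apply, Finsupp.single_eq_of_ne (by simp [hy]), add_zero]
    exact hE _
  · rw [Finsupp.add_apply, Finsupp.single_eq_same]
    simp only [Fin.val_zero, Nat.cast_zero, ← hy]
    omega

theorem Series.isSection {D : (L.chain g).Divisor} {Di : Fin (r + 1) → (L.chain g).Divisor}
    {φ : Fin (r + 1) → (L.chain g).Point → ℝ}
    (h : (L.chain g).Series (Sum.inl 0) (Sum.inr (Fin.last g)) r D (fun i => (r : ℤ) - i) Di φ)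
    (i : Fin (r + 1)) : L.IsSection g r D i (Di i) := by
  refine isSection_iff.2 ⟨⟨_, h.moves i⟩, h.nonneg i, ?_, ?_⟩
  · rw [h.verts, Finsupp.add_apply, Finsupp.single_eq_same, Finsupp.single_eq_of_ne (by simp),
      add_zero]
  · rw [h.verts, Finsupp.add_apply, Finsupp.single_eq_same, Finsupp.single_eq_of_ne (by simp),
      zero_add]

theorem Series.vertexAvoiding {D : (L.chain g).Divisor} {Di : Fin (r + 1) → (L.chain g).Divisor}
    {φ : Fin (r + 1) → (L.chain g).Point → ℝ}
    (h : (L.chain g).Series (Sum.inl 0) (Sum.inr (Fin.last g)) r D (fun i => (r : ℤ) - i) Di φ) :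
    L.VertexAvoiding g r D := fun i =>
  ⟨Di i, Series.isSection h i, fun F hF =>
    have hF := isSection_iff.1 hF
    h.unique i F hF.1 hF.2.1 hF.2.2.1 hF.2.2.2, fun x => h.verts i x⟩

/-- The sections of a vertex avoiding divisor of rank `r` form a series. -/
theorem VertexAvoiding.series {D : (L.chain g).Divisor} (hv : L.VertexAvoiding g r D)
    (hr : (L.chain g).RankGE D r) {Di : Fin (r + 1) → (L.chain g).Divisor}
    (hDi : ∀ i, L.IsSection g r D i (Di i)) {φ : Fin (r + 1) → (L.chain g).Point → ℝ}
    (hφ : ∀ i, (L.chain g).Moves (φ i) D (Di i)) :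
    (L.chain g).Series (Sum.inl 0) (Sum.inr (Fin.last g)) r D (fun i => (r : ℤ) - i) Di φ where
  moves := hφ
  nonneg i p _ := (hDi i).2.2 p
  verts i z := by
    obtain ⟨F, -, h2, h3⟩ := hv i
    rw [h2 _ (hDi i)]
    exact h3 z
  unique i F h1 h2 h3 h4 := by
    obtain ⟨F', -, h6, -⟩ := hv i
    rw [h6 _ (hDi i)]
    exact h6 F (isSection_iff.2 ⟨h1, h2, h3, h4⟩)
  rank t F hF hdeg := by
    classical
    set y := (L.chain g).vert (Sum.inr (Fin.last g)) with hy
    have ht := t.2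
    obtain ⟨E, hE, hDE⟩ := hr (F + Finsupp.single y ((r : ℤ) - t))
      (add_nonneg hF (Finsupp.single_nonneg.2 (by omega)))
      (by rw [degree_add, degree_single, hdeg]; ring)
    refine ⟨E + (F + Finsupp.single y ((r : ℤ) - t)), ?_, fun p hp => ?_, ?_⟩
    · have := hDE.add_right (F + Finsupp.single y ((r : ℤ) - t))
      rwa [sub_add_cancel] at this
    · rw [Finsupp.add_apply, Finsupp.add_apply, Finsupp.single_eq_of_ne hp]
      have : (0 : ℤ) ≤ E p := hE p
      omega
    · rw [Finsupp.add_apply, Finsupp.add_apply, Finsupp.single_eq_same]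
      have h1 : (0 : ℤ) ≤ E y := hE y
      have h2 : (0 : ℤ) ≤ F y := hF y
      omega

theorem card_sym_fin : Fintype.card (Sym (Fin (r + 1)) m) = (r + m).choose m := by
  rw [Sym.card_sym_fin_eq_multichoose, Nat.multichoose_eq]
  congr 1
  omega

/-- In the injective range the cardinality of `A` makes it the set of all multisets. Each `ψ I`
differs from the sum of the `φ i` by a harmonic function, that is, by a constant, and constants can
be absorbed in a tropical dependence. -/
theorem MaximalRankOn.hasIndependentSeries (hinj : InjectiveRange r s ρ m)
    (h : MaximalRankOn L r s ρ m) :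
    L.HasIndependentSeries (genus r s ρ) r m (fun i => (r : ℤ) - i) (curveDegree r s ρ) := by
  classical
  obtain ⟨D, hr, hd, hv, Di, hDi, ψ, hψ, A, hA, hind⟩ := h
  choose φ hφ using fun i => (hDi i).1
  refine ⟨D, Di, φ, hd, hv.series hr.1 hDi hφ, ?_⟩
  have hAu : A = Finset.univ := by
    rw [← Finset.card_eq_iff_eq_univ, card_sym_fin]
    rw [min_eq_left hinj] at hA
    exact_mod_cast hA
  subst hAu
  have hconst : ∀ I : Sym (Fin (r + 1)) m, ∃ a : ℝ, ∀ x,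
      ((I : Multiset (Fin (r + 1))).map fun i => φ i x).sum = ψ I x + a := by
    intro I
    have h1 := moves_multiset_sum hφ (I : Multiset (Fin (r + 1)))
    rw [Sym.card_coe] at h1
    have h2 := (hψ I).int_mul (-1)
    have h3 := h1.1.add h2.1
    obtain ⟨a, ha⟩ := eq_const_of_ord_eq_zero h3 (fun x => by
      rw [h1.1.ord_add h2.1, (hψ I).1.ord_int_mul]
      have e1 := h1.2 x
      have e2 := (hψ I).2 x
      omega) (Sum.inl 0) (chain_connected L _)
    refine ⟨a, fun x => ?_⟩
    have := congrFun ha x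
    push_cast at this
    linarith
  choose a ha using hconst
  rintro ⟨c, hc⟩
  refine hind ⟨fun I => a I + c I, fun x => ?_⟩
  simpa only [ha, add_assoc] using hc x

theorem HasIndependentSeries.maximalRankOn (hinj : InjectiveRange r s ρ m)
    (h : L.HasIndependentSeries (genus r s ρ) r m (fun i => (r : ℤ) - i) (curveDegree r s ρ)) :
    MaximalRankOn L r s ρ m := by
  obtain ⟨D, Di, φ, hd, hs, hind⟩ := h
  refine ⟨D, Series.hasRank hs, hd, Series.vertexAvoiding hs, Di, Series.isSection hs, _,
    fun I => ?_, Finset.univ, ?_, hind⟩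
  · have := moves_multiset_sum hs.moves (I : Multiset (Fin (r + 1)))
    rwa [Sym.card_coe] at this
  · rw [Finset.card_univ, card_sym_fin, min_eq_left hinj]

/-- A series can be continued over one loop without changing its multiplicities. -/
theorem HasIndependentSeries.succ_const {d : ℤ}
    (h : L.HasIndependentSeries g r m (fun i => (r : ℤ) - i) d)
    (hK : ((r : ℝ) + 2) * L.bottom (g + 1) < L.top (g + 1)) :
    L.HasIndependentSeries (g + 1) r m (fun i => (r : ℤ) - i) (d + 1) := by
  -- With N = -1 the indices N - c_i lie between -r - 1 and -1, so they are never 0 or 1 and no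
  -- multiplicity changes.
  have h1 := h.succ (K := r + 2) (N := -1) (by push_cast; exact hK) (by rw [abs_le]; omega)
    (fun i => by have := i.2; rw [abs_le]; omega) (fun i => by have := i.2; omega)
    (fun i j _ => by omega)
  convert h1 using 2 with i
  rw [if_neg]
  have := i.2
  omega

/-- Over `j` further loops, the first `j` multiplicities can be increased by one. -/
theorem HasIndependentSeries.add_loops {d : ℤ}
    (h : L.HasIndependentSeries g r m (fun i => (r : ℤ) - i) d) (j : ℕ) (hj : j ≤ r + 1)
    (hK : ∀ k ∈ Finset.Icc (g + 1) (g + (r + 1)), ((r : ℝ) + 2) * L.bottom k < L.top k) :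
    L.HasIndependentSeries (g + j) r m
      (fun i => if (i : ℕ) < j then (r : ℤ) - i else (r : ℤ) - 1 - i) (d - 1 + j) := by
  induction j with
  | zero =>
    -- The start is the given series with one chip removed at the right end, so that the last
    -- multiplicity is -1.
    convert h.add_const (-1) using 1
    · rfl
    · funext i
      rw [if_neg (Nat.not_lt_zero _)]; ring
    · push_cast; ring
  | succ j ih =>
    -- For N = r - j the index N - c_i is i - j < 0 when i < j and i - j + 1 ≥ 1 otherwise: never 0,
    -- and equal to 1 only for i = j.
    have h1 := (ih (by omega)).succ (K := r + 2) (N := (r : ℤ) - j)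
      (by push_cast; exact hK (g + j + 1) (Finset.mem_Icc.2 ⟨by omega, by omega⟩))
      (by rw [abs_le]; omega)
      (fun i => by have := i.2; rw [abs_le]; split_ifs <;> omega)
      (fun i => by split_ifs <;> omega)
      (fun i k hik => by
        have : (i : ℕ) < k := hik
        split_ifs <;> omega)
    convert h1 using 1
    · rfl
    · funext i
      split_ifs <;> omega
    · push_cast; ring

/-- Indices of points on a loop have absolute value at most r + 2 throughout, and r + 2 ≤ g ≤ 4g, so
condition (i) suffices. -/
theorem Admissible.mul_bottom_lt {b : ℕ} {C : ℝ} (h : L.Admissible g r b C) (hg : r + 2 ≤ g)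
    {k : ℕ} (hk : k ∈ Finset.Icc 1 g) : ((r : ℝ) + 2) * L.bottom k < L.top k := by
  have h1 := h.1 k hk
  have hg' : (r : ℝ) + 2 ≤ g := by exact_mod_cast hg
  have h2 := mul_le_mul_of_nonneg_right hg' (L.bottom_pos k).le
  have h3 : 0 ≤ (g : ℝ) * L.bottom k := mul_nonneg (Nat.cast_nonneg g) (L.bottom_pos k).le
  linarith

end ChainLengths

/-! ### Persistence of the injective range and conclusion -/

open ChainLengths

/-- For m = 1 the inequality would read r + 1 ≤ r - s + 1. -/
theorem InjectiveRange.two_le {r s ρ m : ℕ} (hs : 1 ≤ s) (hm : 1 ≤ m)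
    (h : InjectiveRange r s ρ m) : 2 ≤ m := by
  by_contra! hlt
  obtain rfl : m = 1 := by omega
  simp only [InjectiveRange, expectedDim, curveDegree, Nat.choose_one_right] at h
  push_cast at h
  omega

/-- Genus and degree both grow by 1, so the expected dimension grows by m - 1. -/
theorem InjectiveRange.rho_succ {r s ρ m : ℕ} (hm : 1 ≤ m) (h : InjectiveRange r s ρ m) :
    InjectiveRange r s (ρ + 1) m := by
  refine le_trans h ?_
  have hm : (1 : ℤ) ≤ m := by exact_mod_cast hm
  simp only [expectedDim, curveDegree, genus]
  push_cast
  nlinarith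

/-- The degree grows by r and the genus by r + 1, so the expected dimension grows by mr - (r + 1),
which is nonnegative because m ≥ 2. -/
theorem InjectiveRange.s_succ {r s ρ m : ℕ} (hr : 3 ≤ r) (hs : 1 ≤ s) (hm : 1 ≤ m)
    (h : InjectiveRange r s ρ m) : InjectiveRange r (s + 1) ρ m := by
  have hm2 : (2 : ℤ) ≤ m := by exact_mod_cast h.two_le hs hm
  have hr : (3 : ℤ) ≤ r := by exact_mod_cast hr
  refine le_trans h ?_
  simp only [expectedDim, curveDegree, genus]
  push_cast
  nlinarith

theorem add_two_le_genus_succ (r s ρ : ℕ) (hs : 1 ≤ s) : r + 2 ≤ genus r s ρ + 1 := by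
  have := Nat.mul_le_mul_left (r + 1) hs
  rw [genus]
  omega

theorem theorem1p1 (r s ρ m b : ℕ) (hr : 3 ≤ r) (hs : 1 ≤ s) (hm : 1 ≤ m) (hb : 1 ≤ b)
    (hinj : InjectiveRange r s ρ m) :
    TropicalMaximalRank b r s ρ m →
      TropicalMaximalRank b r s (ρ + 1) m ∧ TropicalMaximalRank b r (s + 1) ρ m := by
  rintro ⟨C, hC, h⟩
  have hg := add_two_le_genus_succ r s ρ hs
  constructor
  · have e : genus r s (ρ + 1) = genus r s ρ + 1 := rfl
    -- The same constant works, because the first loops of an admissible chain form an admissible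
    -- chain for the same `C`.
    refine ⟨C, hC, fun L hL => ?_⟩
    rw [e] at hL
    have h1 := MaximalRankOn.hasIndependentSeries hinj (h L (hL.mono (Nat.le_succ _)))
    refine HasIndependentSeries.maximalRankOn (hinj.rho_succ hm) ?_
    have h2 := h1.succ_const (hL.mul_bottom_lt hg (Finset.mem_Icc.2 ⟨by omega, le_rfl⟩))
    rw [e]
    convert h2 using 1
    rw [curveDegree, curveDegree, e]
    push_cast; ring
  · have e : genus r (s + 1) ρ = genus r s ρ + (r + 1) := by rw [genus, genus]; ring
    refine ⟨C, hC, fun L hL => ?_⟩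
    rw [e] at hL
    have h1 := MaximalRankOn.hasIndependentSeries hinj (h L (hL.mono (Nat.le_add_right _ _)))
    refine HasIndependentSeries.maximalRankOn (hinj.s_succ hr hs hm) ?_
    -- After all r + 1 loops each multiplicity is restored to r - i, and the degree has changed by
    -- -1 + (r + 1) = r.
    have h2 := h1.add_loops (r + 1) le_rfl fun k hk => by
      have hk := Finset.mem_Icc.1 hk
      exact hL.mul_bottom_lt (by omega) (Finset.mem_Icc.2 ⟨by omega, hk.2⟩)
    rw [e]
    convert h2 using 1
    · funext i
      rw [if_pos i.2]
    · rw [curveDegree, curveDegree, e]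
      push_cast; ring
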